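/- **Conventions.** An SSMC is a strict symmetric monoidal category; its symmetries are the morphisms built from braidings and identities by composition and tensor. All functors below are strict symmetric monoidal. For a Petri net $N$ (input and output tokens of each transition listed in some order) $\mathrm{Free}(N)$ is the free SSMC on $N$; its objects are words of places. A functor $H:\mathcal C\to\mathcal D$ between SSMCs with chosen generating morphisms is *transition-preserving* if each generator $f$ is sent to $\sigma; g;\sigma'$ with $g$ a generator and $\sigma,\sigma'$ symmetries. $\mathbf{Set}_*$ (sets and partial functions) and $\mathbf{Span}$ (sets and isomorphism classes of spans) are taken strictified: objects are finite words of sets, morphisms are morphisms between the products of the words. For $S=\mathbf{Set}_*$ or $\mathbf{Span}$, a net with semantics is a pair $(N,N^\sharp)$ with $N^\sharp:\mathrm{Free}(N)\to S$; the same terms are used for any SSMC $\mathcal C$ that is free on a net, and for $S=\mathbf 1$ (terminal SSMC), where the semantics is no extra datum. $(N,N^\sharp)$ is an *identification* of $(M,M^\sharp)$ via $F:\mathrm{Free}(M)\to\mathrm{Free}(N)$ with witnesses $O,\ l,r:\mathrm{Free}(O)\to\mathrm{Free}(M)$ if $F;N^\sharp=M^\sharp$, the functors $l,r$ are transition-preserving,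 $l;M^\sharp=r;M^\sharp$, and $F$ is a coequalizer of $l$ and $r$ in the category of SSMCs and strict symmetric monoidal functors. **Internalization.** For $N^\sharp:\mathrm{Free}(N)\to\mathbf{Set}_*$ the category $\int N^\sharp$ has objects $(X,x)$, $x\in N^\sharp X$; morphisms $(X,x)\to(Y,y)$ are the $f:X\to Y$ with $N^\sharp f(x)=y$. For $N^\sharp:\mathrm{Free}(N)\to\mathbf{Span}$, let there be given a *coherent choice of representatives* of $N^\sharp$: spans $N^\sharp X\leftarrow S_f\to N^\sharp Y$ in the classes $N^\sharp f$, together with identifications of $S_{f;g}$ with the pullback $S_f\times_{N^\sharp Y}S_g$ and of $S_{f\otimes g}$ with $S_f\times S_g$, and elements of the spans of identities and braidings, that satisfy the axioms of an SSMC (equivalently, such that the following is an SSMC with composition and tensor product given by these identifications). Then $\int N^\sharp$ has objects $(X,x)$ as before, and morphisms $(X,x)\to(Y,y)$ are pairs $(f,s)$ with $f:X\to Y$ and $s\in S_f$ lying over $(x,y)$. A functor $G:\mathrm{Free}(K)\to\mathrm{Free}(N)$ induces the choice $S_{Gf}$ for $G;N^\sharp$. A functor $G$ with $G;N^\sharp=K^\sharp$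 lifts to $\hat G:\int K^\sharp\to\int N^\sharp$, $(X,x)\mapsto(GX,x)$, $f\mapsto Gf$ (resp. $(f,s)\mapsto(Gf,s)$). The net $U(\int N^\sharp)$ has as places the pairs $(p,x)$ with $p$ a place and $x\in N^\sharp p$, and as transitions the morphisms of $\int N^\sharp$ lying over transitions of $N$. **Lemma.** Let $(N,N^\sharp)$ be an identification of $(M,M^\sharp)$ via $F$ with witnesses $O,l,r$, with semantics in $\mathbf{Set}_*$. Then $\int(l;M^\sharp)$, $\int M^\sharp$ and $\int N^\sharp$ are the free SSMCs on the nets $U(\int(l;M^\sharp))$, $U(\int M^\sharp)$ and $U(\int N^\sharp)$, and $\int N^\sharp$ (with semantics in $\mathbf 1$) is an identification of $\int M^\sharp$ via $\hat F$ with witnesses $U(\int(l;M^\sharp)),\hat l,\hat r$: that is, $\hat l,\hat r:\int(l;M^\sharp)\to\int M^\sharp$ are transition-preserving, and $\hat F:\int M^\sharp\to\int N^\sharp$ is a coequalizer of $\hat l$ and $\hat r$ in the category of SSMCs. The same holds for semantics in $\mathbf{Span}$, for every coherent choice of representatives of $N^\sharp$ and the induced choices for $M^\sharp=F;N^\sharp$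 and $l;M^\sharp=r;M^\sharp$. -/

import Mathlib

open CategoryTheory

universe v u v₁ u₁ v₂ u₂ v₃ u₃

/-- A strict symmetric monoidal category (the symmetry need not be an identity):
the objects form a monoid, and associativity and unitality of the tensor product hold on the nose. -/
class SSMC (C : Type u) extends Category.{v} C, Monoid C where
  /-- the tensor product of morphisms -/
  tens : ∀ {X Y X' Y' : C}, (X ⟶ Y) → (X' ⟶ Y') → (X * X' ⟶ Y * Y')
  tens_id : ∀ X Y : C, tens (𝟙 X) (𝟙 Y) = 𝟙 (X * Y)
  tens_comp : ∀ {X Y Z X' Y' Z' : C} (f : X ⟶ Y) (g : Y ⟶ Z) (f' : X' ⟶ Y') (g' : Y' ⟶ Z'),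
    tens (f ≫ g) (f' ≫ g') = tens f f' ≫ tens g g'
  one_tens : ∀ {X Y : C} (f : X ⟶ Y), HEq (tens (𝟙 (1 : C)) f) f
  tens_one : ∀ {X Y : C} (f : X ⟶ Y), HEq (tens f (𝟙 (1 : C))) f
  tens_assoc : ∀ {X Y X' Y' X'' Y'' : C} (f : X ⟶ Y) (g : X' ⟶ Y') (h : X'' ⟶ Y''),
    HEq (tens (tens f g) h) (tens f (tens g h))
  /-- the symmetry -/
  braid : ∀ X Y : C, X * Y ⟶ Y * X
  braid_natural : ∀ {X Y X' Y' : C} (f : X ⟶ Y) (g : X' ⟶ Y'),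
    tens f g ≫ braid Y Y' = braid X X' ≫ tens g f
  braid_braid : ∀ X Y : C, braid X Y ≫ braid Y X = 𝟙 (X * Y)
  hexagon : ∀ X Y Z : C, HEq (braid X (Y * Z))
    (tens (braid X Y) (𝟙 Z) ≫ eqToHom (mul_assoc Y X Z) ≫ tens (𝟙 Y) (braid X Z))

namespace SSMC

variable {C : Type u} [SSMC.{v} C]

theorem comp_heq_comp {X Y Z X' Y' Z' : C} (hX : X = X') (hY : Y = Y') (hZ : Z = Z')
    {f : X ⟶ Y} {g : Y ⟶ Z} {f' : X' ⟶ Y'} {g' : Y' ⟶ Z'} (hf : HEq f f') (hg : HEq g g') :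
    HEq (f ≫ g) (f' ≫ g') := by
  subst hX hY hZ; cases hf; cases hg; rfl

theorem tens_heq_tens {X Y Z W X' Y' Z' W' : C} (hX : X = X') (hY : Y = Y') (hZ : Z = Z')
    (hW : W = W') {f : X ⟶ Y} {g : Z ⟶ W} {f' : X' ⟶ Y'} {g' : Z' ⟶ W'} (hf : HEq f f')
    (hg : HEq g g') : HEq (tens f g) (tens f' g') := by
  subst hX hY hZ hW; cases hf; cases hg; rfl

theorem braid_heq_braid {X Y X' Y' : C} (hX : X = X') (hY : Y = Y') :
    HEq (braid X Y) (braid X' Y') := by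
  subst hX hY; rfl

theorem eqToHom_heq_eqToHom {X Y X' Y' : C} (hX : X = X') (hY : Y = Y') (h : X = Y)
    (h' : X' = Y') : HEq (eqToHom h) (eqToHom h') := by
  subst hX hY; rfl

theorem conj_heq {X Y X' Y' : C} (h : X' = X) (h' : Y = Y') (f : X ⟶ Y) :
    HEq (eqToHom h ≫ f ≫ eqToHom h') f := by
  subst h h'; simp

end SSMC

/-- A strict symmetric monoidal functor. -/
structure SSMFunctor (C : Type u₁) [SSMC.{v₁} C] (D : Type u₂) [SSMC.{v₂} D]
    extends C ⥤ D where
  obj_one : obj 1 = 1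
  obj_mul : ∀ X Y : C, obj (X * Y) = obj X * obj Y
  map_tens : ∀ {X Y X' Y' : C} (f : X ⟶ Y) (g : X' ⟶ Y'),
    HEq (map (SSMC.tens f g)) (SSMC.tens (map f) (map g))
  map_braid : ∀ X Y : C, HEq (map (SSMC.braid X Y)) (SSMC.braid (obj X) (obj Y))

theorem CategoryTheory.Functor.map_heq_of_heq {C : Type u₁} [Category.{v₁} C] {D : Type u₂}
    [Category.{v₂} D] (F : C ⥤ D) {X Y X' Y' : C} (hX : X = X') (hY : Y = Y') {f : X ⟶ Y}
    {g : X' ⟶ Y'} (h : HEq f g) : HEq (F.map f) (F.map g) := by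
  subst hX hY; cases h; rfl

namespace SSMFunctor

/-- Composition, in diagrammatic order. -/
def comp {C : Type u₁} [SSMC.{v₁} C] {D : Type u₂} [SSMC.{v₂} D] {E : Type u₃} [SSMC.{v₃} E]
    (F : SSMFunctor C D) (G : SSMFunctor D E) : SSMFunctor C E where
  toFunctor := F.toFunctor ⋙ G.toFunctor
  obj_one := by simp [F.obj_one, G.obj_one]
  obj_mul X Y := by simp [F.obj_mul, G.obj_mul]
  map_tens f g :=
    (G.toFunctor.map_heq_of_heq (F.obj_mul _ _) (F.obj_mul _ _) (F.map_tens f g)).trans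
      (G.map_tens _ _)
  map_braid X Y :=
    (G.toFunctor.map_heq_of_heq (F.obj_mul _ _) (F.obj_mul _ _) (F.map_braid X Y)).trans
      (G.map_braid _ _)

/-- The action on objects, as a homomorphism of monoids. -/
def objHom {C : Type u₁} [SSMC.{v₁} C] {D : Type u₂} [SSMC.{v₂} D] (F : SSMFunctor C D) :
    C →* D where
  toFun := F.obj
  map_one' := F.obj_one
  map_mul' := F.obj_mul

end SSMFunctor

/-- `F` is a coequalizer of `l` and `r` in the category of strict symmetric monoidal categories
and strict symmetric monoidal functors. -/
def IsCoequalizer {O A B : Type u} [SSMC.{u} O] [SSMC.{u} A] [SSMC.{u} B]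
    (l r : SSMFunctor O A) (F : SSMFunctor A B) : Prop :=
  l.comp F = r.comp F ∧
    ∀ (D : Type u) [SSMC.{u} D] (G : SSMFunctor A D), l.comp G = r.comp G →
      ∃! H : SSMFunctor B D, F.comp H = G

/-- The symmetries of a strict symmetric monoidal category: the morphisms built from the
braidings and the identities by composition and tensor product. -/
inductive IsSymmetry {C : Type u} [SSMC.{v} C] : ∀ {X Y : C}, (X ⟶ Y) → Prop
  | id (X : C) : IsSymmetry (𝟙 X)
  | braid (X Y : C) : IsSymmetry (SSMC.braid X Y)
  | comp {X Y Z : C} {f : X ⟶ Y} {g : Y ⟶ Z} :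
      IsSymmetry f → IsSymmetry g → IsSymmetry (f ≫ g)
  | tens {X Y X' Y' : C} {f : X ⟶ Y} {g : X' ⟶ Y'} :
      IsSymmetry f → IsSymmetry g → IsSymmetry (SSMC.tens f g)

/-- A Petri net. The tokens consumed and produced by a transition are listed in a fixed
(arbitrary) order, as is needed to write down the free strict symmetric monoidal category. -/
structure PetriNet where
  Place : Type u
  Trans : Type u
  src : Trans → FreeMonoid Place
  tgt : Trans → FreeMonoid Place

/-- An interpretation of the places and transitions of a net as objects and morphisms of `C`. -/
structure PetriNet.Interp (P : PetriNet.{u}) (C : Type u₁) [SSMC.{v₁} C] where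
  obj : P.Place → C
  hom : ∀ t : P.Trans, FreeMonoid.lift obj (P.src t) ⟶ FreeMonoid.lift obj (P.tgt t)

namespace PetriNet

variable (P : PetriNet.{u})

/-- Formal morphisms between words of places. -/
inductive Term : FreeMonoid P.Place → FreeMonoid P.Place → Type u
  | gen (t : P.Trans) : Term (P.src t) (P.tgt t)
  | cast {X Y : FreeMonoid P.Place} (h : X = Y) : Term X Y
  | comp {X Y Z : FreeMonoid P.Place} : Term X Y → Term Y Z → Term X Z
  | tens {X Y X' Y' : FreeMonoid P.Place} : Term X Y → Term X' Y' → Term (X * X') (Y * Y')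
  | braid (X Y : FreeMonoid P.Place) : Term (X * Y) (Y * X)

variable {P}

/-- The congruence on formal morphisms generated by the axioms of strict symmetric monoidal
categories. The formal morphism `cast h` stands for the identity. -/
inductive TermRel : ∀ {X Y : FreeMonoid P.Place}, P.Term X Y → P.Term X Y → Prop
  | refl {X Y} (f : P.Term X Y) : TermRel f f
  | symm {X Y} {f g : P.Term X Y} : TermRel f g → TermRel g f
  | trans {X Y} {f g h : P.Term X Y} : TermRel f g → TermRel g h → TermRel f h
  | congr_comp {X Y Z} {f f' : P.Term X Y} {g g' : P.Term Y Z} :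
      TermRel f f' → TermRel g g' → TermRel (f.comp g) (f'.comp g')
  | congr_tens {X Y X' Y'} {f f' : P.Term X Y} {g g' : P.Term X' Y'} :
      TermRel f f' → TermRel g g' → TermRel (f.tens g) (f'.tens g')
  | id_comp {X Y} (f : P.Term X Y) : TermRel ((Term.cast rfl).comp f) f
  | comp_id {X Y} (f : P.Term X Y) : TermRel (f.comp (Term.cast rfl)) f
  | assoc {X Y Z W} (f : P.Term X Y) (g : P.Term Y Z) (h : P.Term Z W) :
      TermRel ((f.comp g).comp h) (f.comp (g.comp h))
  | tens_id (X Y) : TermRel ((Term.cast (rfl : X = X)).tens (Term.cast (rfl : Y = Y)))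
      (Term.cast rfl)
  | tens_comp {X Y Z X' Y' Z'} (f : P.Term X Y) (g : P.Term Y Z) (f' : P.Term X' Y')
      (g' : P.Term Y' Z') :
      TermRel ((f.comp g).tens (f'.comp g')) ((f.tens f').comp (g.tens g'))
  | one_tens {X Y} (f : P.Term X Y) :
      TermRel ((Term.cast (rfl : (1 : FreeMonoid P.Place) = 1)).tens f)
        (((Term.cast (one_mul X)).comp f).comp (Term.cast (one_mul Y).symm))
  | tens_one {X Y} (f : P.Term X Y) :
      TermRel (f.tens (Term.cast (rfl : (1 : FreeMonoid P.Place) = 1)))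
        (((Term.cast (mul_one X)).comp f).comp (Term.cast (mul_one Y).symm))
  | tens_assoc {X Y X' Y' X'' Y''} (f : P.Term X Y) (g : P.Term X' Y') (h : P.Term X'' Y'') :
      TermRel ((f.tens g).tens h)
        (((Term.cast (mul_assoc X X' X'')).comp (f.tens (g.tens h))).comp
          (Term.cast (mul_assoc Y Y' Y'').symm))
  | braid_natural {X Y X' Y'} (f : P.Term X Y) (g : P.Term X' Y') :
      TermRel ((f.tens g).comp (Term.braid Y Y')) ((Term.braid X X').comp (g.tens f))
  | braid_braid (X Y) : TermRel ((Term.braid X Y).comp (Term.braid Y X)) (Term.cast rfl)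
  | hexagon (X Y Z) : TermRel (Term.braid X (Y * Z))
      (((Term.cast (mul_assoc X Y Z).symm).comp
        (((Term.braid X Y).tens (Term.cast (rfl : Z = Z))).comp
          ((Term.cast (mul_assoc Y X Z)).comp
            ((Term.cast (rfl : Y = Y)).tens (Term.braid X Z))))).comp
        (Term.cast (mul_assoc Y Z X).symm))

variable (P)

/-- The free strict symmetric monoidal category on a Petri net; its objects are the words of
places. -/
def Free : Type u := FreeMonoid P.Place

namespace Free

instance : Monoid P.Free := inferInstanceAs (Monoid (FreeMonoid P.Place))

instance setoid (X Y : FreeMonoid P.Place) : Setoid (P.Term X Y) where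
  r := TermRel
  iseqv := ⟨TermRel.refl, TermRel.symm, TermRel.trans⟩

instance : Category.{u} P.Free where
  Hom X Y := Quotient (setoid P X Y)
  id X := Quotient.mk _ (Term.cast rfl)
  comp := Quotient.map₂ Term.comp fun _ _ h _ _ h' => TermRel.congr_comp h h'
  id_comp := by rintro X Y ⟨f⟩; exact Quotient.sound (TermRel.id_comp f)
  comp_id := by rintro X Y ⟨f⟩; exact Quotient.sound (TermRel.comp_id f)
  assoc := by rintro X Y Z W ⟨f⟩ ⟨g⟩ ⟨h⟩; exact Quotient.sound (TermRel.assoc f g h)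

variable {P}

/-- The morphism of the free category represented by a formal morphism. -/
def mk {X Y : FreeMonoid P.Place} (f : P.Term X Y) : (show P.Free from X) ⟶ (show P.Free from Y) :=
  Quotient.mk _ f

theorem mk_cast {X Y : FreeMonoid P.Place} (h : X = Y) :
    mk (Term.cast h) = eqToHom (C := P.Free) h := by
  subst h; rfl

theorem mk_heq {X Y X' Y' : FreeMonoid P.Place} (hX : X = X') (hY : Y' = Y) (f : P.Term X Y)
    (g : P.Term X' Y') (h : TermRel f (((Term.cast hX).comp g).comp (Term.cast hY))) :
    HEq (mk f) (mk g) := by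
  subst hX hY
  exact heq_of_eq (Quotient.sound (h.trans ((TermRel.comp_id _).trans (TermRel.id_comp _))))

variable (P)

instance : SSMC.{u} P.Free where
  toCategory := inferInstance
  toMonoid := inferInstance
  tens := Quotient.map₂ Term.tens fun _ _ h _ _ h' => TermRel.congr_tens h h'
  tens_id X Y := Quotient.sound (TermRel.tens_id X Y)
  tens_comp := by
    rintro X Y Z X' Y' Z' ⟨f⟩ ⟨g⟩ ⟨f'⟩ ⟨g'⟩
    exact Quotient.sound (TermRel.tens_comp f g f' g')
  one_tens := by
    rintro X Y ⟨f⟩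
    exact mk_heq _ _ _ _ (TermRel.one_tens f)
  tens_one := by
    rintro X Y ⟨f⟩
    exact mk_heq _ _ _ _ (TermRel.tens_one f)
  tens_assoc := by
    rintro X Y X' Y' X'' Y'' ⟨f⟩ ⟨g⟩ ⟨h⟩
    exact mk_heq _ _ _ _ (TermRel.tens_assoc f g h)
  braid X Y := mk (Term.braid X Y)
  braid_natural := by
    rintro X Y X' Y' ⟨f⟩ ⟨g⟩
    exact Quotient.sound (TermRel.braid_natural f g)
  braid_braid X Y := Quotient.sound (TermRel.braid_braid X Y)
  hexagon X Y Z :=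
    (mk_heq _ _ _ _ (TermRel.hexagon X Y Z)).trans (heq_of_eq
      (congrArg (fun k => mk ((Term.braid X Y).tens (Term.cast (rfl : Z = Z))) ≫ k ≫
        mk ((Term.cast (rfl : Y = Y)).tens (Term.braid X Z))) (mk_cast (mul_assoc Y X Z))))

end Free

/-- The generating objects are the one-letter words. -/
def Free.of (p : P.Place) : P.Free := FreeMonoid.of p

theorem lift_of (w : FreeMonoid P.Place) : FreeMonoid.lift (Free.of P) w = w := by
  induction w using FreeMonoid.inductionOn' with
  | one => rfl
  | of_mul p w ih => rw [map_mul, ih, FreeMonoid.lift_eval_of]; rfl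

/-- The generating objects and morphisms of the free category. -/
def gens : P.Interp P.Free where
  obj := Free.of P
  hom t := eqToHom (P.lift_of _) ≫ Free.mk (Term.gen t) ≫ eqToHom (P.lift_of _).symm

variable {P}

/-- The image of an interpretation under a strict symmetric monoidal functor. -/
def Interp.map {C : Type u₁} [SSMC.{v₁} C] {D : Type u₂} [SSMC.{v₂} D] (i : P.Interp C)
    (F : SSMFunctor C D) : P.Interp D where
  obj p := F.obj (i.obj p)
  hom t :=
    have h (w : FreeMonoid P.Place) :
        FreeMonoid.lift (fun p => F.obj (i.obj p)) w = F.obj (FreeMonoid.lift i.obj w) :=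
      DFunLike.congr_fun (FreeMonoid.hom_eq fun p => by simp [SSMFunctor.objHom] :
        FreeMonoid.lift (fun p => F.obj (i.obj p)) = F.objHom.comp (FreeMonoid.lift i.obj)) w
    eqToHom (h _) ≫ F.map (i.hom t) ≫ eqToHom (h _).symm

/-- `C` is the free strict symmetric monoidal category on the net `P`, with generating objects
and morphisms `i`: every interpretation of `P` extends uniquely along `i`. -/
def Interp.IsFree {C : Type u} [SSMC.{u} C] (i : P.Interp C) : Prop :=
  ∀ (D : Type u) [SSMC.{u} D] (j : P.Interp D), ∃! H : SSMFunctor C D, i.map H = j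

/-- A strict symmetric monoidal functor is transition-preserving (with respect to generators
`i` of `C` and `j` of `D`) if it maps each generating morphism to `σ ≫ g ≫ σ'` with a generating
morphism `g` and symmetries `σ`, `σ'`. -/
def TransitionPreserving {P Q : PetriNet.{u}} {C : Type u₁} [SSMC.{v₁} C] {D : Type u₂}
    [SSMC.{v₂} D] (i : P.Interp C) (j : Q.Interp D) (F : SSMFunctor C D) : Prop :=
  ∀ t : P.Trans, ∃ (g : Q.Trans)
    (σ : F.obj (FreeMonoid.lift i.obj (P.src t)) ⟶ FreeMonoid.lift j.obj (Q.src g))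
    (σ' : FreeMonoid.lift j.obj (Q.tgt g) ⟶ F.obj (FreeMonoid.lift i.obj (P.tgt t))),
    IsSymmetry σ ∧ IsSymmetry σ' ∧ F.map (i.hom t) = σ ≫ j.hom g ≫ σ'

end PetriNet

namespace PetriNet

/-! The category `P.Free` has the universal property of the free category. -/

section Eval

variable {P : PetriNet.{u}} {D : Type u₁} [SSMC.{v₁} D] (j : P.Interp D)

/-- The value of a formal morphism under an interpretation. -/
def eval : ∀ {X Y : FreeMonoid P.Place}, P.Term X Y →
    (FreeMonoid.lift j.obj X ⟶ FreeMonoid.lift j.obj Y)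
  | _, _, .gen t => j.hom t
  | _, _, .cast h => eqToHom (by rw [h])
  | _, _, .comp f g => eval f ≫ eval g
  | _, _, .tens f g => eqToHom (map_mul _ _ _) ≫ SSMC.tens (eval f) (eval g) ≫
      eqToHom (map_mul _ _ _).symm
  | _, _, .braid X Y => eqToHom (map_mul _ _ _) ≫
      SSMC.braid (FreeMonoid.lift j.obj X) (FreeMonoid.lift j.obj Y) ≫
      eqToHom (map_mul _ _ _).symm

theorem map_conj_heq {C : Type u₂} [SSMC.{v₂} C] (F : SSMFunctor C D)
    {X Y X' Y' : C} (h : X' = X) (h' : Y = Y') (f : X ⟶ Y) :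
    HEq (F.map (eqToHom h ≫ f ≫ eqToHom h')) (F.map f) := by subst h h'; simp

theorem eval_tens {X Y X' Y' : FreeMonoid P.Place} (f : P.Term X Y) (g : P.Term X' Y') :
    HEq (eval j (f.tens g)) (SSMC.tens (eval j f) (eval j g)) :=
  SSMC.conj_heq _ _ _

theorem eval_braid (X Y : FreeMonoid P.Place) :
    HEq (eval j (.braid X Y)) (SSMC.braid (FreeMonoid.lift j.obj X)
      (FreeMonoid.lift j.obj Y)) :=
  SSMC.conj_heq _ _ _

theorem eval_conj {X Y X' Y' : FreeMonoid P.Place} (h : X' = X) (h' : Y = Y') (f : P.Term X Y) :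
    HEq (eval j (((Term.cast h).comp f).comp (Term.cast h'))) (eval j f) := by
  subst h h'; simp [eval]

theorem eval_sound {X Y : FreeMonoid P.Place} {f g : P.Term X Y} (h : TermRel f g) :
    eval j f = eval j g := by
  induction h with
  | refl f => rfl
  | symm _ ih => exact ih.symm
  | trans _ _ ih ih' => exact ih.trans ih'
  | congr_comp _ _ ih ih' => simp [eval, ih, ih']
  | congr_tens _ _ ih ih' => simp [eval, ih, ih']
  | id_comp f => simp [eval]
  | comp_id f => simp [eval]
  | assoc f g h => simp [eval]
  | tens_id X Y => simp [eval, SSMC.tens_id]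
  | tens_comp f g f' g' => simp [eval, SSMC.tens_comp]
  | one_tens f =>
    apply eq_of_heq
    refine HEq.trans ((eval_tens j _ _).trans (HEq.trans ?_ (SSMC.one_tens _))) (eval_conj j _ _ _).symm
    exact SSMC.tens_heq_tens (map_one _) (map_one _) rfl rfl (by show HEq (𝟙 (FreeMonoid.lift j.obj 1)) _; rw [map_one]) HEq.rfl
  | tens_one f =>
    apply eq_of_heq
    refine HEq.trans ((eval_tens j _ _).trans (HEq.trans ?_ (SSMC.tens_one _))) (eval_conj j _ _ _).symm
    exact SSMC.tens_heq_tens rfl rfl (map_one _) (map_one _) HEq.rfl (by show HEq (𝟙 (FreeMonoid.lift j.obj 1)) _; rw [map_one])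
  | tens_assoc f g h =>
    apply eq_of_heq
    refine HEq.trans ?_ (eval_conj j _ _ _).symm
    refine (eval_tens j _ _).trans ((SSMC.tens_heq_tens (map_mul _ _ _) (map_mul _ _ _) rfl rfl (eval_tens j f g) HEq.rfl).trans ((SSMC.tens_assoc _ _ _).trans ?_))
    exact ((eval_tens j _ _).trans (SSMC.tens_heq_tens rfl rfl (map_mul _ _ _) (map_mul _ _ _) HEq.rfl (eval_tens j g h))).symm
  | braid_natural f g => simp [eval, reassoc_of% SSMC.braid_natural (C := D)]
  | braid_braid X Y =>
    simp only [eval, Category.assoc, eqToHom_trans_assoc, eqToHom_refl, Category.id_comp]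
    rw [← Category.assoc (SSMC.braid _ _), SSMC.braid_braid]; simp
  | hexagon X Y Z =>
    apply eq_of_heq
    refine HEq.trans ?_ (eval_conj j _ _ _).symm
    have hm := map_mul (FreeMonoid.lift j.obj)
    refine (eval_braid j _ _).trans (HEq.trans ?_ ((SSMC.hexagon (FreeMonoid.lift j.obj X) (FreeMonoid.lift j.obj Y) (FreeMonoid.lift j.obj Z)).trans ?_))
    · rw [hm]
    · refine SSMC.comp_heq_comp (by simp only [hm]) (by simp only [hm]) (by simp only [hm]) ?_ (SSMC.comp_heq_comp (by simp only [hm]) (by simp only [hm]) (by simp only [hm]) (SSMC.eqToHom_heq_eqToHom (by simp only [hm]) (by simp only [hm]) _ _) ?_)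
      · exact ((eval_tens j _ _).trans (SSMC.tens_heq_tens (hm _ _) (hm _ _) rfl rfl (eval_braid j _ _) (heq_of_eq (eqToHom_refl _ _) : HEq (eval j (Term.cast (rfl : Z = Z))) (𝟙 _)))).symm
      · exact ((eval_tens j _ _).trans (SSMC.tens_heq_tens rfl rfl (hm _ _) (hm _ _) (heq_of_eq (eqToHom_refl _ _) : HEq (eval j (Term.cast (rfl : Y = Y))) (𝟙 _)) (eval_braid j _ _))).symm

/-- The extension of an interpretation to the free category. -/
def extend : SSMFunctor P.Free D where
  obj X := FreeMonoid.lift j.obj X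
  map := Quotient.lift (eval j) fun _ _ h => eval_sound j h
  map_id X := rfl
  map_comp := by rintro X Y Z ⟨f⟩ ⟨g⟩; rfl
  obj_one := map_one _
  obj_mul := map_mul _
  map_tens := by rintro X Y X' Y' ⟨f⟩ ⟨g⟩; exact eval_tens j f g
  map_braid X Y := eval_braid j X Y

theorem Interp.ext_of_heq {i i' : P.Interp D} (h : i.obj = i'.obj) (h' : ∀ t, HEq (i.hom t) (i'.hom t)) : i = i' := by
  cases i; cases i'; cases h; congr; funext t; exact eq_of_heq (h' t)

end Eval

theorem gens_isFree (P : PetriNet.{u}) : P.gens.IsFree := by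
  intro D _ j
  refine ⟨extend j, ?_, ?_⟩
  · refine Interp.ext_of_heq (funext fun p => FreeMonoid.lift_eval_of _ _) fun t => ?_
    refine (SSMC.conj_heq _ _ _).trans ?_
    exact map_conj_heq (extend j) _ _ _
  · rintro H rfl
    have ho : ∀ X, H.obj X = (extend (P.gens.map H)).obj X := fun X =>
      DFunLike.congr_fun (FreeMonoid.hom_eq (f := (H.objHom : FreeMonoid P.Place →* D)) (g := FreeMonoid.lift (P.gens.map H).obj) (fun p => (FreeMonoid.lift_eval_of _ _).symm)) X
    have hm : ∀ {X Y} (f : P.Term X Y), HEq (H.map (Free.mk f)) (eval (P.gens.map H) f) := by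
      intro X Y f
      induction f with
      | gen t =>
        refine HEq.symm ((SSMC.conj_heq _ _ _).trans ?_)
        exact map_conj_heq H _ _ _
      | cast h => subst h; exact (heq_of_eq (H.map_id _)).trans (by rw [ho]; rfl)
      | comp f g ihf ihg => exact (heq_of_eq (H.map_comp (Free.mk f) (Free.mk g))).trans (SSMC.comp_heq_comp (ho _) (ho _) (ho _) ihf ihg)
      | tens f g ihf ihg => exact (H.map_tens (Free.mk f) (Free.mk g)).trans ((SSMC.tens_heq_tens (ho _) (ho _) (ho _) (ho _) ihf ihg).trans (eval_tens _ _ _).symm)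
      | braid X Y => 
        refine (H.map_braid (C := P.Free) X Y).trans (HEq.trans ?_ (eval_braid _ _ _).symm)
        have : ∀ {a b a' b' : D}, a = a' → b = b' → HEq (SSMC.braid a b) (SSMC.braid a' b') := by
          rintro _ _ _ _ rfl rfl; rfl
        exact this (ho X) (ho Y)
    have : H.toFunctor = (extend (P.gens.map H)).toFunctor := by
      refine CategoryTheory.Functor.hext ho ?_
      rintro X Y ⟨f⟩
      exact hm f
    generalize extend (P.gens.map H) = K at this
    cases H; cases K; congr

end PetriNet

/-- A word of sets: an object of the strictification of the monoidal category of sets with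
cartesian product. -/
abbrev SetWord : Type (u + 1) := FreeMonoid (Type u)

/-- The product of a list of sets. -/
def ListProd : List (Type u) → Type u
  | [] => PUnit
  | A :: L => A × ListProd L

/-- The set denoted by a word of sets: its product. -/
def El (A : SetWord.{u}) : Type u := ListProd A.toList

namespace El

def appendList : ∀ {A B : List (Type u)}, ListProd A → ListProd B → ListProd (A ++ B)
  | [], _, _, y => y
  | _ :: _, _, (a, x), y => (a, appendList x y)

def splitList : ∀ {A B : List (Type u)}, ListProd (A ++ B) → ListProd A × ListProd B
  | [], _, z => (PUnit.unit, z)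
  | _ :: _, _, (a, z) => ((a, (splitList z).1), (splitList z).2)

theorem splitList_appendList : ∀ {A B : List (Type u)} (x : ListProd A) (y : ListProd B),
    splitList (appendList x y) = (x, y)
  | [], _, _, _ => rfl
  | _ :: _, _, (a, x), y => by
    have := splitList_appendList x y
    simp only [appendList, splitList, this]

theorem appendList_splitList : ∀ {A B : List (Type u)} (z : ListProd (A ++ B)),
    appendList (splitList z).1 (splitList z).2 = z
  | [], _, _ => rfl
  | _ :: A, B, (a, z) => congrArg (Prod.mk a) (appendList_splitList (A := A) (B := B) z)

/-- The canonical identification of the product of a concatenation. -/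
def appendEquiv (A B : SetWord.{u}) : El A × El B ≃ El (A * B) where
  toFun p := appendList (A := A.toList) (B := B.toList) p.1 p.2
  invFun z := splitList (A := A.toList) (B := B.toList) z
  left_inv p := splitList_appendList (A := A.toList) (B := B.toList) p.1 p.2
  right_inv z := appendList_splitList (A := A.toList) (B := B.toList) z

/-- Concatenation of tuples. -/
def append {A B : SetWord.{u}} (x : El A) (y : El B) : El (A * B) := appendEquiv A B (x, y)

/-- The empty tuple. -/
def nil : El (1 : SetWord.{u}) := PUnit.unit

theorem eq_nil (x : El (1 : SetWord.{u})) : x = nil := rfl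

theorem nil_append {A : SetWord.{u}} (x : El A) : HEq (append nil x) x := HEq.rfl

theorem mk_heq {T : Type u} {A B : List (Type u)} (h : A = B) (a : T) {x : ListProd A}
    {y : ListProd B} (hxy : HEq x y) :
    HEq (show ListProd (T :: A) from (a, x)) (show ListProd (T :: B) from (a, y)) := by
  subst h; cases hxy; rfl

theorem appendList_nil : ∀ {A : List (Type u)} (x : ListProd A),
    HEq (appendList x (show ListProd [] from PUnit.unit)) x
  | [], _ => HEq.rfl
  | _ :: _, (a, x) => mk_heq (List.append_nil _) a (appendList_nil x)

theorem append_nil {A : SetWord.{u}} (x : El A) : HEq (append x nil) x :=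
  appendList_nil (A := A.toList) x

theorem appendList_assoc : ∀ {A B C : List (Type u)} (x : ListProd A) (y : ListProd B)
    (z : ListProd C), HEq (appendList (appendList x y) z) (appendList x (appendList y z))
  | [], _, _, _, _, _ => HEq.rfl
  | _ :: _, _, _, (a, x), y, z => mk_heq (List.append_assoc _ _ _) a (appendList_assoc x y z)

theorem append_assoc {A B C : SetWord.{u}} (x : El A) (y : El B) (z : El C) :
    HEq (append (append x y) z) (append x (append y z)) :=
  appendList_assoc (A := A.toList) (B := B.toList) (C := C.toList) x y z

/-- Exchange of two blocks of a tuple. -/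
def swap (A B : SetWord.{u}) : El (A * B) ≃ El (B * A) :=
  ((appendEquiv A B).symm.trans (Equiv.prodComm _ _)).trans (appendEquiv B A)

@[simp] theorem split_append {A B : SetWord.{u}} (x : El A) (y : El B) :
    (appendEquiv A B).symm (append x y) = (x, y) := by simp [append]

@[simp] theorem swap_append {A B : SetWord.{u}} (x : El A) (y : El B) :
    swap A B (append x y) = append y x := by simp [swap, append]

theorem exists_append {A B : SetWord.{u}} (z : El (A * B)) :
    ∃ (x : El A) (y : El B), z = append x y :=
  ⟨((appendEquiv A B).symm z).1, ((appendEquiv A B).symm z).2, by simp [append]⟩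

theorem append_inj {A B : SetWord.{u}} {x x' : El A} {y y' : El B} :
    append x y = append x' y' ↔ x = x' ∧ y = y' := by simp [append]

end El

/-! ### Sets and partial functions -/

/-- The strictified category of sets and partial functions: its objects are words of sets, a
morphism `A ⟶ B` is a partial function between the products of the words. -/
def SetS : Type (u + 1) := SetWord.{u}

namespace SetS

instance : Monoid SetS.{u} := inferInstanceAs (Monoid SetWord.{u})

instance : Category.{u} SetS.{u} where
  Hom A B := El A →. El B
  id A := PFun.id (El A)
  comp f g := g.comp f
  id_comp := PFun.comp_id
  comp_id := PFun.id_comp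
  assoc f g h := (PFun.comp_assoc h g f).symm

/-- The value of a morphism, as a partially defined element. -/
def app {A B : SetS.{u}} (f : A ⟶ B) (x : El A) : Part (El B) := f x

@[ext] theorem hom_ext {A B : SetS.{u}} {f g : A ⟶ B} (h : ∀ x y, y ∈ app f x ↔ y ∈ app g x) :
    f = g := funext fun x => Part.ext (h x)

theorem mem_id {A : SetS.{u}} {x y : El A} : y ∈ app (𝟙 A) x ↔ y = x := by
  change y ∈ Part.some x ↔ _; simp

theorem mem_comp {A B C : SetS.{u}} {f : A ⟶ B} {g : B ⟶ C} {x z} :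
    z ∈ app (f ≫ g) x ↔ ∃ y, y ∈ app f x ∧ z ∈ app g y := by
  change z ∈ (f x).bind g ↔ _; exact Part.mem_bind_iff

/-- A morphism given by a total function. -/
def ofFun {A B : SetS.{u}} (φ : El A → El B) : A ⟶ B := fun x => Part.some (φ x)

theorem mem_ofFun {A B : SetS.{u}} {φ : El A → El B} {x y} : y ∈ app (ofFun φ) x ↔ y = φ x := by
  change y ∈ Part.some (φ x) ↔ _; simp

/-- The product of two partial functions. -/
def tens {A B A' B' : SetS.{u}} (f : A ⟶ B) (g : A' ⟶ B') : A * A' ⟶ B * B' := fun z =>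
  (app f ((El.appendEquiv A A').symm z).1).bind fun y =>
    (app g ((El.appendEquiv A A').symm z).2).map fun y' => El.append y y'

theorem mem_tens {A B A' B' : SetS.{u}} {f : A ⟶ B} {g : A' ⟶ B'} {x : El A} {x' : El A'}
    {y : El B} {y' : El B'} :
    El.append y y' ∈ app (tens f g) (El.append x x') ↔ y ∈ app f x ∧ y' ∈ app g x' := by
  have h : app (tens f g) (El.append x x') =
      (app f x).bind fun y => (app g x').map fun y' => El.append y y' :=
    congrArg (fun p : El A × El A' => (app f p.1).bind fun y =>
      (app g p.2).map fun y' => El.append y y') (El.split_append x x')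
  rw [h]
  refine Part.mem_bind_iff.trans ⟨?_, fun ⟨h₁, h₂⟩ => ⟨y, h₁, (Part.mem_map_iff _).2 ⟨y', h₂, rfl⟩⟩⟩
  rintro ⟨a, ha, hb⟩
  obtain ⟨b, hb', e⟩ := (Part.mem_map_iff _).1 hb
  obtain ⟨rfl, rfl⟩ := El.append_inj.1 e
  exact ⟨ha, hb'⟩

theorem heq_of_mem {A B A' B' : SetS.{u}} (hA : A = A') (hB : B = B') {f : A ⟶ B} {g : A' ⟶ B'}
    (h : ∀ x x' y y', HEq x x' → HEq y y' → (y ∈ app f x ↔ y' ∈ app g x')) : HEq f g := by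
  subst hA hB
  exact heq_of_eq (hom_ext fun x y => h x x y y HEq.rfl HEq.rfl)

theorem mem_eqToHom {A B : SetS.{u}} (h : A = B) {x : El A} {y : El B} :
    y ∈ app (eqToHom h) x ↔ HEq y x := by
  subst h; simp [mem_id]

instance : SSMC.{u} SetS.{u} where
  toCategory := inferInstance
  toMonoid := inferInstance
  tens := tens
  braid A B := ofFun (El.swap A B)
  tens_id A B := by
    ext x y
    obtain ⟨a, b, rfl⟩ := El.exists_append x
    obtain ⟨c, d, rfl⟩ := El.exists_append y
    refine mem_tens.trans (Iff.trans ?_ (El.append_inj.symm.trans mem_id.symm))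
    exact and_congr mem_id mem_id
  tens_comp f g f' g' := by
    ext x y
    obtain ⟨a, b, rfl⟩ := El.exists_append x
    obtain ⟨c, d, rfl⟩ := El.exists_append y
    refine mem_tens.trans (Iff.trans (and_congr mem_comp mem_comp) (Iff.trans ?_ mem_comp.symm))
    constructor
    · rintro ⟨⟨u, hu, hu'⟩, ⟨v, hv, hv'⟩⟩
      exact ⟨El.append u v, mem_tens.2 ⟨hu, hv⟩, mem_tens.2 ⟨hu', hv'⟩⟩
    · rintro ⟨w, hw, hw'⟩
      obtain ⟨u, v, rfl⟩ := El.exists_append w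
      exact ⟨⟨u, (mem_tens.1 hw).1, (mem_tens.1 hw').1⟩, ⟨v, (mem_tens.1 hw).2, (mem_tens.1 hw').2⟩⟩
  one_tens {A B} f := by
    refine heq_of_mem (one_mul A) (one_mul B) fun x x' y y' hx hy => ?_
    obtain rfl := eq_of_heq (hx.trans (El.nil_append x').symm)
    obtain rfl := eq_of_heq (hy.trans (El.nil_append y').symm)
    exact (mem_tens (x := El.nil) (y := El.nil)).trans
      ⟨And.right, fun h => ⟨mem_id.2 rfl, h⟩⟩
  tens_one {A B} f := by
    refine heq_of_mem (mul_one A) (mul_one B) fun x x' y y' hx hy => ?_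
    obtain rfl : x = El.append x' El.nil := eq_of_heq (hx.trans (El.append_nil x').symm)
    obtain rfl : y = El.append y' El.nil := eq_of_heq (hy.trans (El.append_nil y').symm)
    exact mem_tens.trans ⟨And.left, fun h => ⟨h, mem_id.2 rfl⟩⟩
  tens_assoc {A B A' B' A'' B''} f g h := by
    refine heq_of_mem (mul_assoc A A' A'') (mul_assoc B B' B'') fun x x' y y' hx hy => ?_
    obtain ⟨a, b, rfl⟩ := El.exists_append x
    obtain ⟨a, c, rfl⟩ := El.exists_append a
    obtain ⟨d, e, rfl⟩ := El.exists_append y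
    obtain ⟨d, k, rfl⟩ := El.exists_append d
    obtain rfl := eq_of_heq (hx.symm.trans (El.append_assoc a c b))
    obtain rfl := eq_of_heq (hy.symm.trans (El.append_assoc d k e))
    exact mem_tens.trans ((and_congr_left' mem_tens).trans (and_assoc.trans
      (mem_tens.trans (and_congr_right' mem_tens)).symm))
  braid_natural f g := by
    ext x y
    obtain ⟨a, b, rfl⟩ := El.exists_append x
    obtain ⟨c, d, rfl⟩ := El.exists_append y
    refine mem_comp.trans (Iff.trans ?_ mem_comp.symm)
    constructor
    · rintro ⟨w, hw, hw'⟩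
      obtain ⟨u, v, rfl⟩ := El.exists_append w
      obtain ⟨rfl, rfl⟩ := El.append_inj.1 ((mem_ofFun.1 hw').trans (El.swap_append u v))
      exact ⟨El.append b a, mem_ofFun.2 (El.swap_append a b).symm, mem_tens.2 (mem_tens.1 hw).symm⟩
    · rintro ⟨w, hw, hw'⟩
      obtain rfl := (mem_ofFun.1 hw).trans (El.swap_append a b)
      exact ⟨El.append d c, mem_tens.2 (mem_tens.1 hw').symm, mem_ofFun.2 (El.swap_append d c).symm⟩
  braid_braid A B := by
    ext x y
    obtain ⟨a, b, rfl⟩ := El.exists_append x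
    refine mem_comp.trans (Iff.trans ?_ mem_id.symm)
    constructor
    · rintro ⟨w, hw, hw'⟩
      obtain rfl := (mem_ofFun.1 hw).trans (El.swap_append a b)
      exact (mem_ofFun.1 hw').trans (El.swap_append b a)
    · rintro rfl
      exact ⟨El.append b a, mem_ofFun.2 (El.swap_append a b).symm,
        mem_ofFun.2 (El.swap_append b a).symm⟩
  hexagon A B C := by
    refine heq_of_mem (mul_assoc A B C).symm (mul_assoc B C A) fun x x' y y' hx hy => ?_
    obtain ⟨a, b, rfl⟩ := El.exists_append x
    obtain ⟨b, c, rfl⟩ := El.exists_append b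
    obtain rfl := eq_of_heq (hx.symm.trans (El.append_assoc a b c).symm)
    obtain ⟨d, e, rfl⟩ := El.exists_append y'
    obtain ⟨p, q, rfl⟩ := El.exists_append e
    obtain rfl := eq_of_heq (hy.trans (El.append_assoc d p q).symm)
    refine mem_ofFun.trans (Iff.trans ?_ mem_comp.symm)
    constructor
    · intro h
      have h' : El.append (El.append d p) q = El.append (El.append b c) a :=
        h.trans (El.swap_append a (El.append b c))
      obtain ⟨h₀, rfl⟩ := El.append_inj.1 h'
      obtain ⟨rfl, rfl⟩ := El.append_inj.1 h₀
      exact ⟨El.append (El.append d q) p,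
        mem_tens.2 ⟨mem_ofFun.2 (El.swap_append q d).symm, mem_id.2 rfl⟩,
        mem_comp.2 ⟨El.append d (El.append q p), (mem_eqToHom _).2 (El.append_assoc _ _ _).symm,
          mem_tens.2 ⟨mem_id.2 rfl, mem_ofFun.2 (El.swap_append q p).symm⟩⟩⟩
    · rintro ⟨w, hw, hw'⟩
      obtain ⟨w', hw', hw''⟩ := mem_comp.1 hw'
      obtain ⟨u, v, rfl⟩ := El.exists_append w
      obtain ⟨u, u', rfl⟩ := El.exists_append u
      obtain rfl := eq_of_heq (((mem_eqToHom _).1 hw').trans (El.append_assoc u u' v))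
      obtain ⟨h₁, h₂⟩ := mem_tens.1 hw
      obtain ⟨h₃, h₄⟩ := mem_tens.1 hw''
      obtain ⟨rfl, rfl⟩ := El.append_inj.1 ((mem_ofFun.1 h₁).trans (El.swap_append a b))
      obtain rfl := mem_id.1 h₂
      obtain rfl := mem_id.1 h₃
      obtain ⟨rfl, rfl⟩ := El.append_inj.1 ((mem_ofFun.1 h₄).trans (El.swap_append _ _))
      exact (El.swap_append _ (El.append _ _)).symm

end SetS

/-! ### Sets and spans -/

/-- A span of sets `A ← apex → B` between words of sets. -/
structure SetSpan (A B : SetWord.{u}) where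
  apex : Type u
  left : apex → El A
  right : apex → El B

namespace SetSpan

/-- Isomorphism of spans. -/
def Iso {A B : SetWord.{u}} (S T : SetSpan A B) : Prop :=
  ∃ e : S.apex ≃ T.apex, ∀ s, T.left (e s) = S.left s ∧ T.right (e s) = S.right s

instance setoid (A B : SetWord.{u}) : Setoid (SetSpan A B) where
  r := Iso
  iseqv :=
    { refl S := ⟨Equiv.refl _, fun _ => ⟨rfl, rfl⟩⟩
      symm := by
        rintro S T ⟨e, h⟩
        exact ⟨e.symm, fun t => by
          obtain ⟨s, rfl⟩ := e.surjective t
          simp [h s]⟩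
      trans := by
        rintro S T U ⟨e, h⟩ ⟨e', h'⟩
        exact ⟨e.trans e', fun s => ⟨(h' _).1.trans (h s).1, (h' _).2.trans (h s).2⟩⟩ }

/-- The span of a function. -/
def graph {A B : SetWord.{u}} (φ : El A → El B) : SetSpan A B := ⟨El A, id, φ⟩

/-- Composition by pullback. -/
def comp {A B C : SetWord.{u}} (S : SetSpan A B) (T : SetSpan B C) : SetSpan A C where
  apex := { p : S.apex × T.apex // S.right p.1 = T.left p.2 }
  left p := S.left p.1.1
  right p := T.right p.1.2

/-- The product of two spans. -/
def tens {A B A' B' : SetWord.{u}} (S : SetSpan A B) (T : SetSpan A' B') :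
    SetSpan (A * A') (B * B') where
  apex := S.apex × T.apex
  left p := El.append (S.left p.1) (T.left p.2)
  right p := El.append (S.right p.1) (T.right p.2)

theorem Iso.comp {A B C : SetWord.{u}} {S S' : SetSpan A B} {T T' : SetSpan B C} (h : Iso S S')
    (h' : Iso T T') : Iso (S.comp T) (S'.comp T') := by
  obtain ⟨e, h⟩ := h
  obtain ⟨e', h'⟩ := h'
  exact ⟨(e.prodCongr e').subtypeEquiv fun p => by simp [h, h'], fun p =>
    ⟨(h _).1, (h' _).2⟩⟩

theorem Iso.tens {A B A' B' : SetWord.{u}} {S S' : SetSpan A B} {T T' : SetSpan A' B'}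
    (h : Iso S S') (h' : Iso T T') : Iso (S.tens T) (S'.tens T') := by
  obtain ⟨e, h⟩ := h
  obtain ⟨e', h'⟩ := h'
  exact ⟨e.prodCongr e', fun p =>
    ⟨congrArg₂ El.append (h _).1 (h' _).1, congrArg₂ El.append (h _).2 (h' _).2⟩⟩

theorem comp_graph {A B C : SetWord.{u}} (S : SetSpan A B) (φ : El B → El C) :
    Iso (S.comp (graph φ)) ⟨S.apex, S.left, φ ∘ S.right⟩ :=
  ⟨{ toFun p := p.1.1
     invFun s := ⟨(s, S.right s), rfl⟩
     left_inv := by rintro ⟨⟨s, b⟩, h⟩; exact Subtype.ext (Prod.ext rfl h)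
     right_inv _ := rfl }, by rintro ⟨⟨s, b⟩, h⟩; exact ⟨rfl, congrArg φ h⟩⟩

/-- Precomposing with the graph of a bijection. -/
theorem graph_equiv_comp {A B C : SetWord.{u}} (φ : El A ≃ El B) (T : SetSpan B C) :
    Iso ((graph φ).comp T) ⟨T.apex, φ.symm ∘ T.left, T.right⟩ :=
  ⟨{ toFun p := p.1.2
     invFun t := ⟨(φ.symm (T.left t), t), φ.apply_symm_apply _⟩
     left_inv := by
       rintro ⟨⟨a, t⟩, h⟩
       exact Subtype.ext (Prod.ext ((φ.symm_apply_eq).2 h.symm) rfl)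
     right_inv _ := rfl }, by
     rintro ⟨⟨a, t⟩, h⟩; exact ⟨(φ.symm_apply_eq).2 h.symm, rfl⟩⟩

theorem tens_graph {A B A' B' : SetWord.{u}} (φ : El A → El B) (ψ : El A' → El B')
    (χ : El (A * A') → El (B * B')) (h : ∀ a b, χ (El.append a b) = El.append (φ a) (ψ b)) :
    Iso ((graph φ).tens (graph ψ)) (graph χ) :=
  ⟨El.appendEquiv A A', fun p => ⟨rfl, h p.1 p.2⟩⟩

end SetSpan

/-- The strictified category of sets and spans: its objects are words of sets, a morphism
`A ⟶ B` is an isomorphism class of spans between the products of the words. -/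
def SpanS : Type (u + 1) := SetWord.{u}

namespace SpanS

open SetSpan

instance : Monoid SpanS.{u} := inferInstanceAs (Monoid SetWord.{u})

instance : Category.{u + 1} SpanS.{u} where
  Hom A B := Quotient (SetSpan.setoid A B)
  id A := Quotient.mk _ (graph id)
  comp := Quotient.map₂ SetSpan.comp fun _ _ h _ _ h' => h.comp h'
  id_comp := by
    rintro A B ⟨S⟩
    exact Quotient.sound (graph_equiv_comp (Equiv.refl _) S)
  comp_id := by
    rintro A B ⟨S⟩
    exact Quotient.sound (comp_graph S id)
  assoc := by
    rintro A B C D ⟨S⟩ ⟨T⟩ ⟨U⟩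
    exact Quotient.sound
      ⟨{ toFun p := ⟨(p.1.1.1.1, ⟨(p.1.1.1.2, p.1.2), p.2⟩), p.1.1.2⟩
         invFun p := ⟨(⟨(p.1.1, p.1.2.1.1), p.2⟩, p.1.2.1.2), p.1.2.2⟩
         left_inv _ := rfl
         right_inv _ := rfl }, fun _ => ⟨rfl, rfl⟩⟩

/-- The isomorphism class of a span, as a morphism. -/
def mk {A B : SetWord.{u}} (S : SetSpan A B) : (show SpanS.{u} from A) ⟶ (show SpanS.{u} from B) :=
  Quotient.mk _ S

theorem mk_eq {A B : SetWord.{u}} {S T : SetSpan A B} (h : Iso S T) : mk S = mk T :=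
  Quotient.sound h

theorem mk_heq {A B A' B' : SetWord.{u}} (hA : A = A') (hB : B = B') {S : SetSpan A B}
    {T : SetSpan A' B'} (e : S.apex ≃ T.apex)
    (h : ∀ s, HEq (T.left (e s)) (S.left s) ∧ HEq (T.right (e s)) (S.right s)) :
    HEq (mk S) (mk T) := by
  subst hA hB
  exact heq_of_eq (mk_eq ⟨e, fun s => ⟨eq_of_heq (h s).1, eq_of_heq (h s).2⟩⟩)

theorem mk_graph_heq {A B A' B' : SetWord.{u}} (hA : A = A') (hB : B = B') {φ : El A → El B}
    {ψ : El A' → El B'} (h : ∀ a a', HEq a a' → HEq (φ a) (ψ a')) :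
    HEq (mk (graph φ)) (mk (graph ψ)) := by
  subst hA hB
  obtain rfl : φ = ψ := funext fun a => eq_of_heq (h a a HEq.rfl)
  rfl

theorem eqToHom_eq {A B : SetWord.{u}} (h : A = B) :
    eqToHom (C := SpanS.{u}) h = mk (graph (cast (congrArg El h))) := by
  subst h; rfl

theorem mk_graph_comp {A B C : SetWord.{u}} (φ : El A → El B) (ψ : El B → El C) :
    mk (graph φ) ≫ mk (graph ψ) = mk (graph (ψ ∘ φ)) :=
  Quotient.sound (comp_graph (graph φ) ψ)

theorem cast_append_assoc {A B C : SetWord.{u}} (h : El (A * B * C) = El (A * (B * C))) (x : El A)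
    (y : El B) (z : El C) : cast h (El.append (El.append x y) z) =
      El.append x (El.append y z) :=
  eq_of_heq ((cast_heq _ _).trans (El.append_assoc x y z))

/-- The product of two functions. -/
def prodMap {A B A' B' : SetWord.{u}} (φ : El A → El B) (ψ : El A' → El B') (z : El (A * A')) :
    El (B * B') :=
  El.append (φ ((El.appendEquiv A A').symm z).1) (ψ ((El.appendEquiv A A').symm z).2)

@[simp] theorem prodMap_append {A B A' B' : SetWord.{u}} (φ : El A → El B) (ψ : El A' → El B')
    (x : El A) (y : El A') : prodMap φ ψ (El.append x y) = El.append (φ x) (ψ y) := by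
  simp [prodMap]

theorem hexagon_aux {A B C : SetWord.{u}} (h : El (B * A * C) = El (B * (A * C))) (a : El A) (b : El B)
    (c : El C) : prodMap id (El.swap A C) (cast h
      (prodMap (El.swap A B) id (El.append (El.append a b) c))) =
        El.append b (El.append c a) := by
  simp [cast_append_assoc]

instance : SSMC.{u + 1} SpanS.{u} where
  toCategory := inferInstance
  toMonoid := inferInstance
  tens := Quotient.map₂ SetSpan.tens fun _ _ h _ _ h' => h.tens h'
  braid A B := mk (graph (El.swap A B))
  tens_id A B := Quotient.sound (tens_graph id id id fun _ _ => rfl)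
  tens_comp := by
    rintro A B C A' B' C' ⟨S⟩ ⟨T⟩ ⟨S'⟩ ⟨T'⟩
    refine Quotient.sound
      ⟨{ toFun p := ⟨((p.1.1.1, p.2.1.1), (p.1.1.2, p.2.1.2)),
           congrArg₂ El.append p.1.2 p.2.2⟩
         invFun p := (⟨(p.1.1.1, p.1.2.1), (El.append_inj.1 p.2).1⟩,
           ⟨(p.1.1.2, p.1.2.2), (El.append_inj.1 p.2).2⟩)
         left_inv _ := rfl
         right_inv _ := rfl }, fun _ => ⟨rfl, rfl⟩⟩
  one_tens := by
    rintro A B ⟨S⟩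
    exact mk_heq (one_mul _) (one_mul _) (S := (graph id).tens S) (T := S)
      { toFun p := p.2
        invFun s := (El.nil, s)
        left_inv _ := rfl
        right_inv _ := rfl } fun _ => ⟨HEq.rfl, HEq.rfl⟩
  tens_one := by
    rintro A B ⟨S⟩
    exact mk_heq (mul_one _) (mul_one _) (S := S.tens (graph id)) (T := S)
      { toFun p := p.1
        invFun s := (s, El.nil)
        left_inv _ := rfl
        right_inv _ := rfl } fun _ => ⟨(El.append_nil _).symm, (El.append_nil _).symm⟩
  tens_assoc := by
    rintro A B A' B' A'' B'' ⟨S⟩ ⟨T⟩ ⟨U⟩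
    exact mk_heq (mul_assoc _ _ _) (mul_assoc _ _ _) (S := (S.tens T).tens U)
      (T := S.tens (T.tens U)) (Equiv.prodAssoc _ _ _) fun _ =>
        ⟨(El.append_assoc _ _ _).symm, (El.append_assoc _ _ _).symm⟩
  braid_natural := by
    rintro A B A' B' ⟨S⟩ ⟨T⟩
    refine (mk_eq (comp_graph (S.tens T) (El.swap B B'))).trans (Eq.symm
      ((mk_eq (graph_equiv_comp (El.swap A A') (T.tens S))).trans (mk_eq ?_)))
    exact ⟨Equiv.prodComm _ _, fun p => ⟨((El.swap A A').symm_apply_eq.2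
      (El.swap_append _ _).symm).symm, El.swap_append _ _⟩⟩
  braid_braid A B := by
    refine (mk_graph_comp _ _).trans (congrArg (fun φ => mk (graph φ)) (funext fun x => ?_))
    obtain ⟨a, b, rfl⟩ := El.exists_append x
    exact (congrArg (El.swap B A) (El.swap_append a b)).trans (El.swap_append b a)
  hexagon A B C := by
    have h₁ : mk ((graph (El.swap A B)).tens (graph (id : El C → El C))) =
        mk (graph (prodMap (El.swap A B) id)) := mk_eq (tens_graph _ _ _ (prodMap_append _ _))
    have h₂ : mk ((graph (id : El B → El B)).tens (graph (El.swap A C))) =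
        mk (graph (prodMap id (El.swap A C))) := mk_eq (tens_graph _ _ _ (prodMap_append _ _))
    have h₃ := eqToHom_eq (mul_assoc (B : SetWord.{u}) A C)
    refine HEq.trans ?_ (heq_of_eq (congr (congrArg₂ (fun a b c => a ≫ b ≫ c) h₁ h₃) h₂)).symm
    refine HEq.trans ?_ (heq_of_eq ((congrArg _ (mk_graph_comp _ _)).trans
      (mk_graph_comp _ _))).symm
    refine mk_graph_heq (mul_assoc _ _ _).symm (mul_assoc _ _ _) fun x x' hx => ?_
    obtain ⟨a, b, rfl⟩ := El.exists_append x
    obtain ⟨b, c, rfl⟩ := El.exists_append b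
    obtain rfl := eq_of_heq (hx.symm.trans (El.append_assoc a b c).symm)
    exact (heq_of_eq (El.swap_append a (El.append b c))).trans ((El.append_assoc b c a).trans
      (heq_of_eq (hexagon_aux (congrArg El (mul_assoc (B : SetWord.{u}) A C)) a b c).symm))

end SpanS

/-! ### Coherent systems of spans and the Grothendieck construction -/

section Elements

variable {B : Type u} [SSMC.{u} B] (ω : B →* SetWord.{u})

/-- The empty tuple, as an element over the unit object. -/
def elOne : El (ω 1) := cast (congrArg El (map_one ω).symm) El.nil

/-- Concatenation of elements. -/
def elMul {X Y : B} (x : El (ω X)) (y : El (ω Y)) : El (ω (X * Y)) :=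
  cast (congrArg El (map_mul ω X Y).symm) (El.append x y)

end Elements

/-- A coherent system of spans indexed by a strict symmetric monoidal category `B`. It assigns to
each object `X` the set `El (ω X)` and to each morphism `f : X ⟶ Y` a span from `El (ω X)` to
`El (ω Y)`, written as the family `Fib f x y` of the sets of those elements of the apex that
connect `x` to `y`. The span of `f ≫ g` is the composite (pullback) of the spans of `f` and `g`
through the maps `comp`, the span of a tensor product is the product through the maps `tens`, and
these identifications satisfy the axioms of a strict symmetric monoidal category. -/
structure CoherentSpans (B : Type u) [SSMC.{u} B] where
  ω : B →* SetWord.{u}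
  Fib : ∀ {X Y : B}, (X ⟶ Y) → El (ω X) → El (ω Y) → Type u
  id : ∀ {X : B} (x : El (ω X)), Fib (𝟙 X) x x
  comp : ∀ {X Y Z : B} {f : X ⟶ Y} {g : Y ⟶ Z} {x : El (ω X)} {y : El (ω Y)} {z : El (ω Z)},
    Fib f x y → Fib g y z → Fib (f ≫ g) x z
  tens : ∀ {X Y X' Y' : B} {f : X ⟶ Y} {g : X' ⟶ Y'} {x : El (ω X)} {y : El (ω Y)}
    {x' : El (ω X')} {y' : El (ω Y')},
    Fib f x y → Fib g x' y' → Fib (SSMC.tens f g) (elMul ω x x') (elMul ω y y')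
  braid : ∀ {X Y : B} (x : El (ω X)) (y : El (ω Y)),
    Fib (SSMC.braid X Y) (elMul ω x y) (elMul ω y x)
  id_comp : ∀ {X Y : B} {f : X ⟶ Y} {x : El (ω X)} {y : El (ω Y)} (s : Fib f x y),
    HEq (comp (id x) s) s
  comp_id : ∀ {X Y : B} {f : X ⟶ Y} {x : El (ω X)} {y : El (ω Y)} (s : Fib f x y),
    HEq (comp s (id y)) s
  comp_assoc : ∀ {X Y Z W : B} {f : X ⟶ Y} {g : Y ⟶ Z} {h : Z ⟶ W} {x : El (ω X)} {y : El (ω Y)}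
    {z : El (ω Z)} {w : El (ω W)} (s : Fib f x y) (t : Fib g y z) (r : Fib h z w),
    HEq (comp (comp s t) r) (comp s (comp t r))
  tens_id : ∀ {X Y : B} (x : El (ω X)) (y : El (ω Y)),
    HEq (tens (id x) (id y)) (id (elMul ω x y))
  tens_comp : ∀ {X Y Z X' Y' Z' : B} {f : X ⟶ Y} {g : Y ⟶ Z} {f' : X' ⟶ Y'} {g' : Y' ⟶ Z'}
    {x : El (ω X)} {y : El (ω Y)} {z : El (ω Z)} {x' : El (ω X')} {y' : El (ω Y')}
    {z' : El (ω Z')} (s : Fib f x y) (t : Fib g y z) (s' : Fib f' x' y') (t' : Fib g' y' z'),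
    HEq (tens (comp s t) (comp s' t')) (comp (tens s s') (tens t t'))
  one_tens : ∀ {X Y : B} {f : X ⟶ Y} {x : El (ω X)} {y : El (ω Y)} (s : Fib f x y),
    HEq (tens (id (elOne ω)) s) s
  tens_one : ∀ {X Y : B} {f : X ⟶ Y} {x : El (ω X)} {y : El (ω Y)} (s : Fib f x y),
    HEq (tens s (id (elOne ω))) s
  tens_assoc : ∀ {X Y X' Y' X'' Y'' : B} {f : X ⟶ Y} {g : X' ⟶ Y'} {h : X'' ⟶ Y''}
    {x : El (ω X)} {y : El (ω Y)} {x' : El (ω X')} {y' : El (ω Y')} {x'' : El (ω X'')}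
    {y'' : El (ω Y'')} (s : Fib f x y) (t : Fib g x' y') (r : Fib h x'' y''),
    HEq (tens (tens s t) r) (tens s (tens t r))
  braid_natural : ∀ {X Y X' Y' : B} {f : X ⟶ Y} {g : X' ⟶ Y'} {x : El (ω X)} {y : El (ω Y)}
    {x' : El (ω X')} {y' : El (ω Y')} (s : Fib f x y) (t : Fib g x' y'),
    HEq (comp (tens s t) (braid y y')) (comp (braid x x') (tens t s))
  braid_braid : ∀ {X Y : B} (x : El (ω X)) (y : El (ω Y)),
    HEq (comp (braid x y) (braid y x)) (id (elMul ω x y))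
  hexagon : ∀ {X Y Z : B} (x : El (ω X)) (y : El (ω Y)) (z : El (ω Z))
    (e : Fib (eqToHom (mul_assoc Y X Z)) (elMul ω (elMul ω y x) z) (elMul ω y (elMul ω x z))),
    HEq (braid x (elMul ω y z)) (comp (tens (braid x y) (id z)) (comp e (tens (id y) (braid x z))))
  comp_bijective : ∀ {X Y Z : B} (f : X ⟶ Y) (g : Y ⟶ Z) (x : El (ω X)) (z : El (ω Z)),
    Function.Bijective (fun p : Σ y : El (ω Y), Fib f x y × Fib g y z => comp p.2.1 p.2.2)
  tens_bijective : ∀ {X Y X' Y' : B} (f : X ⟶ Y) (g : X' ⟶ Y') (x : El (ω X)) (y : El (ω Y))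
    (x' : El (ω X')) (y' : El (ω Y')),
    Function.Bijective (fun p : Fib f x y × Fib g x' y' => tens p.1 p.2)

section Elements

variable {B : Type u} [SSMC.{u} B] (ω : B →* SetWord.{u})

theorem elMul_heq_append {X Y : B} (x : El (ω X)) (y : El (ω Y)) :
    HEq (elMul ω x y) (El.append x y) := cast_heq _ _

theorem elOne_heq_nil : HEq (elOne ω) El.nil := cast_heq _ _

theorem El.append_heq {A A' C C' : SetWord.{u}} (hA : A = A') (hC : C = C') {x : El A} {x' : El A'}
    {y : El C} {y' : El C'} (hx : HEq x x') (hy : HEq y y') :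
    HEq (El.append x y) (El.append x' y') := by
  subst hA hC; cases hx; cases hy; rfl

theorem one_elMul {X : B} (x : El (ω X)) : HEq (elMul ω (elOne ω) x) x :=
  (elMul_heq_append ω _ _).trans
    ((El.append_heq (map_one ω) rfl (elOne_heq_nil ω) HEq.rfl).trans (El.nil_append x))

theorem elMul_one {X : B} (x : El (ω X)) : HEq (elMul ω x (elOne ω)) x :=
  (elMul_heq_append ω _ _).trans
    ((El.append_heq rfl (map_one ω) HEq.rfl (elOne_heq_nil ω)).trans (El.append_nil x))

theorem elMul_assoc {X Y Z : B} (x : El (ω X)) (y : El (ω Y)) (z : El (ω Z)) :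
    HEq (elMul ω (elMul ω x y) z) (elMul ω x (elMul ω y z)) :=
  (elMul_heq_append ω _ _).trans
    ((El.append_heq (map_mul ω X Y) rfl (elMul_heq_append ω x y) HEq.rfl).trans
      ((El.append_assoc x y z).trans
        ((El.append_heq rfl (map_mul ω Y Z) HEq.rfl (elMul_heq_append ω y z)).symm.trans
          (elMul_heq_append ω _ _).symm)))

theorem cast_bijective' {α β : Type u} (h : α = β) : Function.Bijective (cast h) := by
  subst h; exact Function.bijective_id

theorem elMul_bijective (X Y : B) :
    Function.Bijective (fun p : El (ω X) × El (ω Y) => elMul ω p.1 p.2) :=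
  (cast_bijective' _).comp (El.appendEquiv (ω X) (ω Y)).bijective

/-- The decomposition of an element over a tensor product. -/
noncomputable def elSplit (X Y : B) : El (ω (X * Y)) ≃ El (ω X) × El (ω Y) :=
  (Equiv.ofBijective _ (elMul_bijective ω X Y)).symm

theorem elMul_elSplit {X Y : B} (z : El (ω (X * Y))) :
    elMul ω (elSplit ω X Y z).1 (elSplit ω X Y z).2 = z :=
  (elSplit ω X Y).symm_apply_apply z

end Elements

namespace CoherentSpans

variable {A B : Type u} [SSMC.{u} A] [SSMC.{u} B]

section Congr

variable (D : CoherentSpans B)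

theorem id_heq {X X' : B} (hX : X = X') {x : El (D.ω X)} {x' : El (D.ω X')} (hx : HEq x x') :
    HEq (D.id x) (D.id x') := by
  subst hX; cases hx; rfl

theorem comp_heq {X Y Z X' Y' Z' : B} (hX : X = X') (hY : Y = Y') (hZ : Z = Z')
    {f : X ⟶ Y} {g : Y ⟶ Z} {f' : X' ⟶ Y'} {g' : Y' ⟶ Z'} (hf : HEq f f') (hg : HEq g g')
    {x : El (D.ω X)} {y : El (D.ω Y)} {z : El (D.ω Z)} {x' : El (D.ω X')} {y' : El (D.ω Y')}
    {z' : El (D.ω Z')} (hx : HEq x x') (hy : HEq y y') (hz : HEq z z')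
    {s : D.Fib f x y} {t : D.Fib g y z} {s' : D.Fib f' x' y'} {t' : D.Fib g' y' z'}
    (hs : HEq s s') (ht : HEq t t') : HEq (D.comp s t) (D.comp s' t') := by
  subst hX hY hZ; cases hf; cases hg; cases hx; cases hy; cases hz; cases hs; cases ht; rfl

theorem tens_heq {X Y Z W X' Y' Z' W' : B} (hX : X = X') (hY : Y = Y') (hZ : Z = Z') (hW : W = W')
    {f : X ⟶ Y} {g : Z ⟶ W} {f' : X' ⟶ Y'} {g' : Z' ⟶ W'} (hf : HEq f f') (hg : HEq g g')
    {x : El (D.ω X)} {y : El (D.ω Y)} {z : El (D.ω Z)} {w : El (D.ω W)} {x' : El (D.ω X')}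
    {y' : El (D.ω Y')} {z' : El (D.ω Z')} {w' : El (D.ω W')} (hx : HEq x x') (hy : HEq y y')
    (hz : HEq z z') (hw : HEq w w')
    {s : D.Fib f x y} {t : D.Fib g z w} {s' : D.Fib f' x' y'} {t' : D.Fib g' z' w'}
    (hs : HEq s s') (ht : HEq t t') : HEq (D.tens s t) (D.tens s' t') := by
  subst hX hY hZ hW; cases hf; cases hg; cases hx; cases hy; cases hz; cases hw; cases hs
  cases ht; rfl

theorem braid_heq {X Y X' Y' : B} (hX : X = X') (hY : Y = Y') {x : El (D.ω X)} {y : El (D.ω Y)}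
    {x' : El (D.ω X')} {y' : El (D.ω Y')} (hx : HEq x x') (hy : HEq y y') :
    HEq (D.braid x y) (D.braid x' y') := by
  subst hX hY; cases hx; cases hy; rfl

theorem fib_congr {X Y X' Y' : B} (hX : X = X') (hY : Y = Y') {f : X ⟶ Y} {f' : X' ⟶ Y'}
    (hf : HEq f f') {x : El (D.ω X)} {y : El (D.ω Y)} {x' : El (D.ω X')} {y' : El (D.ω Y')}
    (hx : HEq x x') (hy : HEq y y') : D.Fib f x y = D.Fib f' x' y' := by
  subst hX hY; cases hf; cases hx; cases hy; rfl

theorem eq_id {X : B} {x y : El (D.ω X)} (s : D.Fib (𝟙 X) x y) :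
    ∃ _ : x = y, HEq s (D.id x) := by
  have h : D.comp s (D.id y) = D.comp (D.id x) s := eq_of_heq ((D.comp_id s).trans (D.id_comp s).symm)
  have := (D.comp_bijective (𝟙 X) (𝟙 X) x y).1 (a₁ := ⟨y, s, D.id y⟩) (a₂ := ⟨x, D.id x, s⟩) h
  obtain ⟨h₁, h₂⟩ := Sigma.mk.inj_iff.1 this
  subst h₁
  exact ⟨rfl, heq_of_eq (Prod.ext_iff.1 (eq_of_heq h₂)).1⟩

theorem eq_braid {X Y : B} {x : El (D.ω X)} {y : El (D.ω Y)} {z : El (D.ω (Y * X))}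
    (s : D.Fib (SSMC.braid X Y) (elMul D.ω x y) z) :
    ∃ _ : z = elMul D.ω y x, HEq s (D.braid x y) := by
  obtain ⟨⟨y', x'⟩, rfl⟩ := (elMul_bijective D.ω Y X).2 z
  change D.Fib _ _ (elMul D.ω y' x') at s
  have key : ∀ (e : X * Y ⟶ X * Y) (_ : e = 𝟙 _) (k : D.Fib e (elMul D.ω x y) (elMul D.ω x' y')),
      elMul D.ω x y = elMul D.ω x' y' := by
    rintro _ rfl k; exact (D.eq_id k).1
  have h := key _ (SSMC.braid_braid X Y) (D.comp s (D.braid y' x'))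
  have h' := (elMul_bijective D.ω X Y).1 (a₁ := (x, y)) (a₂ := (x', y')) h
  obtain ⟨rfl, rfl⟩ := Prod.mk.inj h'
  have key : ∀ (e : X * Y ⟶ X * Y) (_ : e = 𝟙 _) (k k' : D.Fib e (elMul D.ω x y) (elMul D.ω x y)),
      k = k' := by
    rintro _ rfl k k'
    exact eq_of_heq ((D.eq_id k).2.trans (D.eq_id k').2.symm)
  have h := key _ (SSMC.braid_braid X Y) (D.comp s (D.braid y x)) (D.comp (D.braid x y) (D.braid y x))
  have := (D.comp_bijective _ _ _ _).1 (a₁ := ⟨_, s, D.braid y x⟩)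
    (a₂ := ⟨_, D.braid x y, D.braid y x⟩) h
  obtain ⟨_, h₂⟩ := Sigma.mk.inj_iff.1 this
  exact ⟨rfl, heq_of_eq (Prod.ext_iff.1 (eq_of_heq h₂)).1⟩

end Congr

/-- The span assigned to a morphism. -/
def span (D : CoherentSpans B) {X Y : B} (f : X ⟶ Y) : SetSpan (D.ω X) (D.ω Y) where
  apex := Σ (x : El (D.ω X)) (y : El (D.ω Y)), D.Fib f x y
  left s := s.1
  right s := s.2.1

/-- The functor to the category of spans (up to isomorphism) that is represented by a coherent
system of spans. -/
def toSpan (D : CoherentSpans B) : SSMFunctor B SpanS.{u} where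
  obj X := D.ω X
  map f := SpanS.mk (D.span f)
  map_id X := by
    refine SpanS.mk_eq (B := D.ω X) ⟨⟨fun s => s.1, fun x => ⟨x, x, D.id x⟩, ?_, ?_⟩, ?_⟩
    · rintro ⟨x, y, s⟩
      obtain ⟨rfl, h⟩ := D.eq_id s
      cases h; rfl
    · intro x; rfl
    · rintro ⟨x, y, s⟩
      exact ⟨rfl, (D.eq_id s).1⟩
  map_comp {X Y Z} f g := by
    refine (SpanS.mk_eq (A := D.ω X) (B := D.ω Z) ?_).symm
    refine ⟨Equiv.ofBijective (fun p => ⟨p.1.1.1, p.1.2.2.1,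
      D.comp p.1.1.2.2 (cast (congrArg (fun y => D.Fib g y _) p.2.symm) p.1.2.2.2)⟩) ⟨?_, ?_⟩, ?_⟩
    · rintro ⟨⟨⟨x, y, s⟩, ⟨y', z, t⟩⟩, h⟩ ⟨⟨⟨x₁, y₁, s₁⟩, ⟨y₁', z₁, t₁⟩⟩, h₁⟩ e
      change y = y' at h
      change y₁ = y₁' at h₁
      subst h h₁
      obtain ⟨rfl, e⟩ := Sigma.mk.inj_iff.1 e
      obtain ⟨rfl, e⟩ := Sigma.mk.inj_iff.1 (eq_of_heq e)
      have := (D.comp_bijective f g x z).1 (a₁ := ⟨y, s, t⟩) (a₂ := ⟨y₁, s₁, t₁⟩) (eq_of_heq e)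
      cases this; rfl
    · rintro ⟨x, z, r⟩
      obtain ⟨⟨y, s, t⟩, rfl⟩ := (D.comp_bijective f g x z).2 r
      exact ⟨⟨⟨⟨x, y, s⟩, ⟨y, z, t⟩⟩, rfl⟩, rfl⟩
    · intro p; exact ⟨rfl, rfl⟩
  obj_one := map_one D.ω
  obj_mul := map_mul D.ω
  map_tens {X Y X' Y'} f g := by
    refine (SpanS.mk_heq (map_mul D.ω X X').symm (map_mul D.ω Y Y').symm
      (S := (D.span f).tens (D.span g)) (T := D.span (SSMC.tens f g))
      (Equiv.ofBijective (fun p => ⟨elMul D.ω p.1.1 p.2.1,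
        elMul D.ω p.1.2.1 p.2.2.1, D.tens p.1.2.2 p.2.2.2⟩) ⟨?_, ?_⟩) ?_).symm
    · rintro ⟨⟨x, y, s⟩, ⟨x', y', t⟩⟩ ⟨⟨x₁, y₁, s₁⟩, ⟨x₁', y₁', t₁⟩⟩ e
      obtain ⟨e₁, e⟩ := Sigma.mk.inj_iff.1 e
      have := (elMul_bijective D.ω X X').1 (a₁ := (x, x')) (a₂ := (x₁, x₁')) e₁
      obtain ⟨rfl, rfl⟩ := Prod.mk.inj this
      obtain ⟨e₂, e⟩ := Sigma.mk.inj_iff.1 (eq_of_heq e)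
      have := (elMul_bijective D.ω Y Y').1 (a₁ := (y, y')) (a₂ := (y₁, y₁')) e₂
      obtain ⟨rfl, rfl⟩ := Prod.mk.inj this
      have := (D.tens_bijective f g x y x' y').1 (a₁ := (s, t)) (a₂ := (s₁, t₁)) (eq_of_heq e)
      cases this; rfl
    · rintro ⟨z, w, r⟩
      obtain ⟨⟨x, x'⟩, rfl⟩ := (elMul_bijective D.ω X X').2 z
      obtain ⟨⟨y, y'⟩, rfl⟩ := (elMul_bijective D.ω Y Y').2 w
      obtain ⟨⟨s, t⟩, rfl⟩ := (D.tens_bijective f g x y x' y').2 r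
      exact ⟨⟨⟨x, y, s⟩, ⟨x', y', t⟩⟩, rfl⟩
    · intro p
      exact ⟨elMul_heq_append _ _ _, elMul_heq_append _ _ _⟩
  map_braid X Y := by
    refine (SpanS.mk_heq (map_mul D.ω X Y).symm (map_mul D.ω Y X).symm
      (S := SetSpan.graph (El.swap (D.ω X) (D.ω Y))) (T := D.span (SSMC.braid X Y))
      (Equiv.ofBijective (fun z => ⟨elMul D.ω ((El.appendEquiv _ _).symm z).1
        ((El.appendEquiv _ _).symm z).2, elMul D.ω ((El.appendEquiv _ _).symm z).2
        ((El.appendEquiv _ _).symm z).1, D.braid _ _⟩) ⟨?_, ?_⟩) ?_).symm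
    · intro z z' e
      have := (elMul_bijective D.ω X Y).1 (Sigma.mk.inj_iff.1 e).1
      exact (El.appendEquiv _ _).symm.injective this
    · rintro ⟨z, w, s⟩
      obtain ⟨⟨x, y⟩, rfl⟩ := (elMul_bijective D.ω X Y).2 z
      obtain ⟨e, h⟩ := D.eq_braid s
      subst e
      obtain rfl := eq_of_heq h
      exact ⟨El.append x y, congrArg (fun p : El (D.ω X) × El (D.ω Y) =>
        (⟨elMul D.ω p.1 p.2, elMul D.ω p.2 p.1, D.braid p.1 p.2⟩ :
          (D.span (SSMC.braid X Y)).apex)) (El.split_append x y)⟩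
    · intro z
      obtain ⟨x, y, rfl⟩ := El.exists_append z
      refine ⟨?_, ?_⟩
      · exact (heq_of_eq (congrArg (fun p : El (D.ω X) × El (D.ω Y) => elMul D.ω p.1 p.2)
          (El.split_append x y))).trans (elMul_heq_append D.ω x y)
      · exact (heq_of_eq (congrArg (fun p : El (D.ω X) × El (D.ω Y) => elMul D.ω p.2 p.1)
          (El.split_append x y))).trans ((elMul_heq_append D.ω y x).trans
            (heq_of_eq (El.swap_append x y).symm))

section OfSet

variable (G : SSMFunctor B SetS.{u})

/-- `G f (x) = y`. -/
def Sends {X Y : B} (f : X ⟶ Y) (x : El (G.objHom X)) (y : El (G.objHom Y)) : Prop :=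
  y ∈ SetS.app (G.map f) x

theorem _root_.SetS.mem_heq {A B A' B' : SetS.{u}} (hA : A = A') (hB : B = B') {f : A ⟶ B}
    {f' : A' ⟶ B'} (hf : HEq f f') {x : El A} {y : El B} {x' : El A'} {y' : El B'}
    (hx : HEq x x') (hy : HEq y y') : y ∈ SetS.app f x ↔ y' ∈ SetS.app f' x' := by
  subst hA hB; cases hf; cases hx; cases hy; rfl

theorem sends_id {X : B} {x y : El (G.objHom X)} : Sends G (𝟙 X) x y ↔ y = x :=
  (SetS.mem_heq rfl rfl (heq_of_eq (G.map_id X)) HEq.rfl HEq.rfl).trans SetS.mem_id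

theorem sends_comp {X Y Z : B} {f : X ⟶ Y} {g : Y ⟶ Z} {x : El (G.objHom X)}
    {z : El (G.objHom Z)} : Sends G (f ≫ g) x z ↔ ∃ y, Sends G f x y ∧ Sends G g y z :=
  (SetS.mem_heq rfl rfl (heq_of_eq (G.map_comp f g)) HEq.rfl HEq.rfl).trans SetS.mem_comp

theorem sends_tens {X Y X' Y' : B} {f : X ⟶ Y} {g : X' ⟶ Y'} {x : El (G.objHom X)}
    {y : El (G.objHom Y)} {x' : El (G.objHom X')} {y' : El (G.objHom Y')} :
    Sends G (SSMC.tens f g) (elMul (B := B) G.objHom x x') (elMul (B := B) G.objHom y y') ↔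
      Sends G f x y ∧ Sends G g x' y' :=
  (SetS.mem_heq (G.obj_mul _ _) (G.obj_mul _ _) (G.map_tens f g) (elMul_heq_append _ _ _)
    (elMul_heq_append _ _ _)).trans SetS.mem_tens

theorem sends_braid {X Y : B} (x : El (G.objHom X)) (y : El (G.objHom Y)) :
    Sends G (SSMC.braid X Y) (elMul (B := B) G.objHom x y) (elMul (B := B) G.objHom y x) :=
  (SetS.mem_heq (G.obj_mul _ _) (G.obj_mul _ _) (G.map_braid X Y) (elMul_heq_append _ _ _)
    (elMul_heq_append _ _ _)).2 (SetS.mem_ofFun.2 (El.swap_append x y).symm)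

theorem heq_of_sends {X Y X' Y' : B} (hX : X = X') (hY : Y = Y') {f : X ⟶ Y} {f' : X' ⟶ Y'}
    (hf : HEq f f') {x : El (G.objHom X)} {y : El (G.objHom Y)} {x' : El (G.objHom X')}
    {y' : El (G.objHom Y')} (hx : HEq x x') (hy : HEq y y')
    (s : ULift.{u} (PLift (Sends G f x y))) (s' : ULift.{u} (PLift (Sends G f' x' y'))) :
    HEq s s' := by
  subst hX hY; cases hf; cases hx; cases hy; exact heq_of_eq (Subsingleton.elim _ _)

/-- The coherent system of spans of a functor to sets and partial functions: over `f`, `x`, `y`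
there is one element if `G f (x) = y`, and none otherwise. -/
def ofSet : CoherentSpans B where
  ω := G.objHom
  Fib f x y := ULift.{u} (PLift (Sends G f x y))
  id x := ⟨⟨(sends_id G).2 rfl⟩⟩
  comp s t := ⟨⟨(sends_comp G).2 ⟨_, s.1.1, t.1.1⟩⟩⟩
  tens s t := ⟨⟨(sends_tens G).2 ⟨s.1.1, t.1.1⟩⟩⟩
  braid x y := ⟨⟨sends_braid G x y⟩⟩
  id_comp s := heq_of_sends G rfl rfl (heq_of_eq (Category.id_comp _)) HEq.rfl HEq.rfl _ _
  comp_id s := heq_of_sends G rfl rfl (heq_of_eq (Category.comp_id _)) HEq.rfl HEq.rfl _ _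
  comp_assoc s t r := heq_of_sends G rfl rfl (heq_of_eq (Category.assoc _ _ _)) HEq.rfl HEq.rfl _ _
  tens_id x y := heq_of_sends G rfl rfl (heq_of_eq (SSMC.tens_id _ _)) HEq.rfl HEq.rfl _ _
  tens_comp s t s' t' :=
    heq_of_sends G rfl rfl (heq_of_eq (SSMC.tens_comp _ _ _ _)) HEq.rfl HEq.rfl _ _
  one_tens s := heq_of_sends G (one_mul _) (one_mul _) (SSMC.one_tens _) (one_elMul _ _)
    (one_elMul _ _) _ _
  tens_one s := heq_of_sends G (mul_one _) (mul_one _) (SSMC.tens_one _) (elMul_one _ _)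
    (elMul_one _ _) _ _
  tens_assoc s t r := heq_of_sends G (mul_assoc _ _ _) (mul_assoc _ _ _) (SSMC.tens_assoc _ _ _)
    (elMul_assoc _ _ _ _) (elMul_assoc _ _ _ _) _ _
  braid_natural s t :=
    heq_of_sends G rfl rfl (heq_of_eq (SSMC.braid_natural _ _)) HEq.rfl HEq.rfl _ _
  braid_braid x y := heq_of_sends G rfl rfl (heq_of_eq (SSMC.braid_braid _ _)) HEq.rfl HEq.rfl _ _
  hexagon x y z e := heq_of_sends G (mul_assoc _ _ _).symm (mul_assoc _ _ _) (SSMC.hexagon _ _ _)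
    (elMul_assoc _ _ _ _).symm (elMul_assoc _ _ _ _) _ _
  comp_bijective f g x z := by
    refine ⟨?_, ?_⟩
    · rintro ⟨y, s, t⟩ ⟨y', s', t'⟩ _
      obtain rfl : y = y' := Part.mem_unique s.1.1 s'.1.1
      obtain rfl : s = s' := Subsingleton.elim _ _
      obtain rfl : t = t' := Subsingleton.elim _ _
      rfl
    · rintro ⟨⟨h⟩⟩
      obtain ⟨y, h₁, h₂⟩ := (sends_comp G).1 h
      exact ⟨⟨y, ⟨⟨h₁⟩⟩, ⟨⟨h₂⟩⟩⟩, rfl⟩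
  tens_bijective f g x y x' y' := by
    refine ⟨fun _ _ _ => Subsingleton.elim _ _, ?_⟩
    rintro ⟨⟨h⟩⟩
    exact ⟨⟨⟨⟨((sends_tens G).1 h).1⟩⟩, ⟨⟨((sends_tens G).1 h).2⟩⟩⟩, rfl⟩

end OfSet

section Pullback

variable (D : CoherentSpans B) (F : SSMFunctor A B)

theorem elMul_pullback {X Y : A} (x : El (D.ω (F.obj X))) (y : El (D.ω (F.obj Y))) :
    HEq (elMul (B := A) (D.ω.comp F.objHom) x y) (elMul D.ω x y) :=
  (elMul_heq_append (B := A) (D.ω.comp F.objHom) x y).trans (elMul_heq_append D.ω x y).symm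

theorem elOne_pullback : HEq (elOne (B := A) (D.ω.comp F.objHom)) (elOne D.ω) :=
  (elOne_heq_nil (B := A) (D.ω.comp F.objHom)).trans (elOne_heq_nil D.ω).symm

theorem elMul_heq {X Y X' Y' : B} (hX : X = X') (hY : Y = Y') {x : El (D.ω X)} {y : El (D.ω Y)}
    {x' : El (D.ω X')} {y' : El (D.ω Y')} (hx : HEq x x') (hy : HEq y y') :
    HEq (elMul D.ω x y) (elMul D.ω x' y') := by
  subst hX hY; cases hx; cases hy; rfl

theorem elMul_pullback₂ {X Y Z : A} (x : El (D.ω (F.obj X))) (y : El (D.ω (F.obj Y)))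
    (z : El (D.ω (F.obj Z))) :
    HEq (elMul (B := A) (D.ω.comp F.objHom) (elMul (B := A) (D.ω.comp F.objHom) x y) z)
      (elMul D.ω (elMul D.ω x y) z) :=
  (D.elMul_pullback F _ _).trans
    (D.elMul_heq (F.obj_mul X Y) rfl (D.elMul_pullback F x y) HEq.rfl)

theorem elMul_pullback₂' {X Y Z : A} (x : El (D.ω (F.obj X))) (y : El (D.ω (F.obj Y)))
    (z : El (D.ω (F.obj Z))) :
    HEq (elMul (B := A) (D.ω.comp F.objHom) x (elMul (B := A) (D.ω.comp F.objHom) y z))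
      (elMul D.ω x (elMul D.ω y z)) :=
  (D.elMul_pullback F _ _).trans
    (D.elMul_heq rfl (F.obj_mul Y Z) HEq.rfl (D.elMul_pullback F y z))

theorem fib_id_pullback {X : A} (x : El (D.ω (F.obj X))) :
    D.Fib (𝟙 (F.obj X)) x x = D.Fib (F.map (𝟙 X)) x x := by rw [F.map_id]

theorem fib_comp_pullback {X Y Z : A} (f : X ⟶ Y) (g : Y ⟶ Z) (x : El (D.ω (F.obj X)))
    (z : El (D.ω (F.obj Z))) :
    D.Fib (F.map f ≫ F.map g) x z = D.Fib (F.map (f ≫ g)) x z := by rw [F.map_comp]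

theorem fib_tens_pullback {X Y X' Y' : A} (f : X ⟶ Y) (g : X' ⟶ Y') (x : El (D.ω (F.obj X)))
    (y : El (D.ω (F.obj Y))) (x' : El (D.ω (F.obj X'))) (y' : El (D.ω (F.obj Y'))) :
    D.Fib (SSMC.tens (F.map f) (F.map g)) (elMul D.ω x x') (elMul D.ω y y') =
      D.Fib (F.map (SSMC.tens f g)) (elMul (B := A) (D.ω.comp F.objHom) x x')
        (elMul (B := A) (D.ω.comp F.objHom) y y') :=
  D.fib_congr (F.obj_mul _ _).symm (F.obj_mul _ _).symm (F.map_tens f g).symm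
    (D.elMul_pullback F x x').symm (D.elMul_pullback F y y').symm

theorem fib_braid_pullback {X Y : A} (x : El (D.ω (F.obj X))) (y : El (D.ω (F.obj Y))) :
    D.Fib (SSMC.braid (F.obj X) (F.obj Y)) (elMul D.ω x y) (elMul D.ω y x) =
      D.Fib (F.map (SSMC.braid X Y)) (elMul (B := A) (D.ω.comp F.objHom) x y)
        (elMul (B := A) (D.ω.comp F.objHom) y x) :=
  D.fib_congr (F.obj_mul _ _).symm (F.obj_mul _ _).symm (F.map_braid X Y).symm
    (D.elMul_pullback F x y).symm (D.elMul_pullback F y x).symm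

theorem cast_comp_bijective {α β γ : Type u} {φ : α → β} (h : β = γ)
    (hφ : Function.Bijective φ) : Function.Bijective (fun a => cast h (φ a)) := by
  subst h; exact hφ

/-- The pullback of a coherent system of spans along a strict symmetric monoidal functor `F`: the
span of `f` is the span of `F f`. -/
def pullback : CoherentSpans A where
  ω := D.ω.comp F.objHom
  Fib f x y := D.Fib (F.map f) x y
  id {X} x := cast (D.fib_id_pullback F x) (D.id (X := F.obj X) x)
  comp {X Y Z f g x y z} s t := cast (D.fib_comp_pullback F f g x z) (D.comp s t)
  tens {X Y X' Y' f g x y x' y'} s t := cast (D.fib_tens_pullback F f g x y x' y') (D.tens s t)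
  braid {X Y} x y :=
    cast (D.fib_braid_pullback F x y) (D.braid (X := F.obj X) (Y := F.obj Y) x y)
  id_comp {X Y f x y} s := (cast_heq _ _).trans
    ((D.comp_heq rfl rfl rfl (heq_of_eq (F.map_id X)) HEq.rfl HEq.rfl HEq.rfl HEq.rfl
      (cast_heq _ _) HEq.rfl).trans (D.id_comp s))
  comp_id {X Y f x y} s := (cast_heq _ _).trans
    ((D.comp_heq rfl rfl rfl HEq.rfl (heq_of_eq (F.map_id Y)) HEq.rfl HEq.rfl HEq.rfl
      HEq.rfl (cast_heq _ _)).trans (D.comp_id s))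
  comp_assoc s t r := (cast_heq _ _).trans
    ((D.comp_heq rfl rfl rfl (heq_of_eq (F.map_comp _ _)) HEq.rfl HEq.rfl HEq.rfl HEq.rfl
      (cast_heq _ _) HEq.rfl).trans ((D.comp_assoc s t r).trans
    ((cast_heq _ _).trans (D.comp_heq rfl rfl rfl HEq.rfl (heq_of_eq (F.map_comp _ _)) HEq.rfl
      HEq.rfl HEq.rfl HEq.rfl (cast_heq _ _))).symm))
  tens_id {X Y} x y := (cast_heq _ _).trans
    ((D.tens_heq rfl rfl rfl rfl (heq_of_eq (F.map_id X)) (heq_of_eq (F.map_id Y)) HEq.rfl HEq.rfl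
      HEq.rfl HEq.rfl (cast_heq _ _) (cast_heq _ _)).trans ((D.tens_id x y).trans
    ((cast_heq _ _).trans (D.id_heq (F.obj_mul X Y) (D.elMul_pullback F x y))).symm))
  tens_comp s t s' t' := (cast_heq _ _).trans
    ((D.tens_heq rfl rfl rfl rfl (heq_of_eq (F.map_comp _ _)) (heq_of_eq (F.map_comp _ _)) HEq.rfl
      HEq.rfl HEq.rfl HEq.rfl (cast_heq _ _) (cast_heq _ _)).trans
    ((D.tens_comp s t s' t').trans
    ((cast_heq _ _).trans (D.comp_heq (F.obj_mul _ _) (F.obj_mul _ _) (F.obj_mul _ _)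
      (F.map_tens _ _) (F.map_tens _ _) (D.elMul_pullback F _ _) (D.elMul_pullback F _ _)
      (D.elMul_pullback F _ _) (cast_heq _ _) (cast_heq _ _))).symm))
  one_tens s := (cast_heq _ _).trans
    ((D.tens_heq F.obj_one F.obj_one rfl rfl
      ((F.toFunctor.map_id 1).heq.trans (by rw [F.obj_one])) HEq.rfl
      (D.elOne_pullback F) (D.elOne_pullback F) HEq.rfl HEq.rfl
      ((cast_heq _ _).trans (D.id_heq F.obj_one (D.elOne_pullback F))) HEq.rfl).trans
      (D.one_tens s))
  tens_one s := (cast_heq _ _).trans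
    ((D.tens_heq rfl rfl F.obj_one F.obj_one HEq.rfl
      ((F.toFunctor.map_id 1).heq.trans (by rw [F.obj_one])) HEq.rfl HEq.rfl
      (D.elOne_pullback F) (D.elOne_pullback F) HEq.rfl
      ((cast_heq _ _).trans (D.id_heq F.obj_one (D.elOne_pullback F)))).trans
      (D.tens_one s))
  tens_assoc s t r := (cast_heq _ _).trans
    ((D.tens_heq (F.obj_mul _ _) (F.obj_mul _ _) rfl rfl (F.map_tens _ _) HEq.rfl
      (D.elMul_pullback F _ _) (D.elMul_pullback F _ _) HEq.rfl HEq.rfl (cast_heq _ _)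
      HEq.rfl).trans ((D.tens_assoc s t r).trans
    ((cast_heq _ _).trans (D.tens_heq rfl rfl (F.obj_mul _ _) (F.obj_mul _ _) HEq.rfl
      (F.map_tens _ _) HEq.rfl HEq.rfl (D.elMul_pullback F _ _) (D.elMul_pullback F _ _) HEq.rfl
      (cast_heq _ _))).symm))
  braid_natural s t := (cast_heq _ _).trans
    ((D.comp_heq (F.obj_mul _ _) (F.obj_mul _ _) (F.obj_mul _ _) (F.map_tens _ _)
      (F.map_braid _ _) (D.elMul_pullback F _ _) (D.elMul_pullback F _ _) (D.elMul_pullback F _ _)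
      (cast_heq _ _) (cast_heq _ _)).trans ((D.braid_natural s t).trans
    ((cast_heq _ _).trans (D.comp_heq (F.obj_mul _ _) (F.obj_mul _ _) (F.obj_mul _ _)
      (F.map_braid _ _) (F.map_tens _ _) (D.elMul_pullback F _ _) (D.elMul_pullback F _ _)
      (D.elMul_pullback F _ _) (cast_heq _ _) (cast_heq _ _))).symm))
  braid_braid x y := (cast_heq _ _).trans
    ((D.comp_heq (F.obj_mul _ _) (F.obj_mul _ _) (F.obj_mul _ _) (F.map_braid _ _)
      (F.map_braid _ _) (D.elMul_pullback F _ _) (D.elMul_pullback F _ _) (D.elMul_pullback F _ _)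
      (cast_heq _ _) (cast_heq _ _)).trans ((D.braid_braid _ _).trans
    ((cast_heq _ _).trans (D.id_heq (F.obj_mul _ _) (D.elMul_pullback F _ _))).symm))
  hexagon {X Y Z} x y z e := by
    have h₁ : F.obj (Y * X * Z) = F.obj Y * F.obj X * F.obj Z := by rw [F.obj_mul, F.obj_mul]
    have h₂ : F.obj (Y * (X * Z)) = F.obj Y * (F.obj X * F.obj Z) := by rw [F.obj_mul, F.obj_mul]
    have h₃ : F.obj (X * Y * Z) = F.obj X * F.obj Y * F.obj Z := by rw [F.obj_mul, F.obj_mul]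
    have h₄ : F.obj (Y * (Z * X)) = F.obj Y * (F.obj Z * F.obj X) := by rw [F.obj_mul, F.obj_mul]
    have k₁ := D.elMul_pullback₂ F y x z
    have k₂ := D.elMul_pullback₂' F y x z
    have k₃ := D.elMul_pullback₂ F x y z
    have k₄ := D.elMul_pullback₂' F y z x
    have he : HEq (F.map (eqToHom (mul_assoc Y X Z)))
        (eqToHom (mul_assoc (F.obj Y) (F.obj X) (F.obj Z))) :=
      (heq_of_eq (eqToHom_map F.toFunctor _)).trans (SSMC.eqToHom_heq_eqToHom h₁ h₂ _ _)
    have t₁ := D.tens_heq (F.obj_mul X Y) (F.obj_mul Y X) rfl rfl (F.map_braid X Y)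
      (heq_of_eq (F.map_id Z)) (D.elMul_pullback F x y) (D.elMul_pullback F y x) HEq.rfl HEq.rfl
      (cast_heq (D.fib_braid_pullback F x y) (D.braid (X := F.obj X) (Y := F.obj Y) x y))
      (cast_heq (D.fib_id_pullback F z) (D.id (X := F.obj Z) z))
    have t₂ := D.tens_heq rfl rfl (F.obj_mul X Z) (F.obj_mul Z X) (heq_of_eq (F.map_id Y))
      (F.map_braid X Z) HEq.rfl HEq.rfl (D.elMul_pullback F x z) (D.elMul_pullback F z x)
      (cast_heq (D.fib_id_pullback F y) (D.id (X := F.obj Y) y))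
      (cast_heq (D.fib_braid_pullback F x z) (D.braid (X := F.obj X) (Y := F.obj Z) x z))
    have m₁ := (F.map_tens (SSMC.braid X Y) (𝟙 Z)).trans
      (SSMC.tens_heq_tens (F.obj_mul X Y) (F.obj_mul Y X) rfl rfl (F.map_braid X Y)
        (heq_of_eq (F.map_id Z)))
    have m₂ := (F.map_tens (𝟙 Y) (SSMC.braid X Z)).trans
      (SSMC.tens_heq_tens rfl rfl (F.obj_mul X Z) (F.obj_mul Z X) (heq_of_eq (F.map_id Y))
        (F.map_braid X Z))
    refine (cast_heq _ _).trans ((D.braid_heq rfl (F.obj_mul Y Z) HEq.rfl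
      (D.elMul_pullback F y z)).trans ((D.hexagon (X := F.obj X) (Y := F.obj Y) (Z := F.obj Z)
      x y z (cast (D.fib_congr h₁ h₂ he k₁ k₂) e)).trans (HEq.symm ((cast_heq _ _).trans ?_))))
    refine D.comp_heq h₃ h₁ h₄ m₁ ?_ k₃ k₁ k₄ ((cast_heq _ _).trans t₁) ((cast_heq _ _).trans ?_)
    · exact (heq_of_eq (F.map_comp _ _)).trans (heq_comp h₁ h₂ h₄ he m₂)
    · exact D.comp_heq h₁ h₂ h₄ he m₂ k₁ k₂ k₄ (cast_heq _ _).symm ((cast_heq _ _).trans t₂)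
  comp_bijective f g x z := cast_comp_bijective _ (D.comp_bijective (F.map f) (F.map g) x z)
  tens_bijective f g x y x' y' :=
    cast_comp_bijective _ (D.tens_bijective (F.map f) (F.map g) x y x' y')

end Pullback

end CoherentSpans

namespace CoherentSpans

variable {A B O : Type u} [SSMC.{u} A] [SSMC.{u} B] [SSMC.{u} O]

theorem ofSet_comp (F : SSMFunctor A B) (G : SSMFunctor B SetS.{u}) :
    ofSet (F.comp G) = (ofSet G).pullback F := rfl

theorem toSpan_pullback (D : CoherentSpans B) (F : SSMFunctor A B) :
    (D.pullback F).toSpan = F.comp D.toSpan := rfl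

theorem pullback_pullback (D : CoherentSpans B) (F : SSMFunctor A B) (l : SSMFunctor O A) :
    (D.pullback F).pullback l = D.pullback (l.comp F) := by
  unfold pullback
  congr 1
  all_goals
    funext
    exact cast_cast _ _ _

theorem pullback_eq_of_comp_eq (D : CoherentSpans B) {F : SSMFunctor A B} {l r : SSMFunctor O A}
    (h : l.comp F = r.comp F) : (D.pullback F).pullback l = (D.pullback F).pullback r := by
  rw [pullback_pullback, pullback_pullback, h]

/-- The Grothendieck construction of a coherent system of spans `D`. The objects are the pairs
`(X, x)` of an object `X` and an element `x` of its set; the morphisms from `(X, x)` to `(Y, y)`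
are the pairs `(f, s)` of a morphism `f : X ⟶ Y` and an element `s` of the apex of the span of `f`
that connects `x` to `y`. -/
structure Total (D : CoherentSpans B) where
  base : B
  el : El (D.ω base)

namespace Total

variable {D : CoherentSpans B}

theorem ext_heq {a b : Total D} (h : a.base = b.base) (h' : HEq a.el b.el) : a = b := by
  cases a; cases b; cases h; cases h'; rfl

instance : Monoid (Total D) where
  mul a b := ⟨a.base * b.base, elMul D.ω a.el b.el⟩
  one := ⟨1, elOne D.ω⟩
  mul_assoc a b c := ext_heq (mul_assoc a.base b.base c.base) (elMul_assoc D.ω a.el b.el c.el)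
  one_mul a := ext_heq (one_mul a.base) (one_elMul D.ω a.el)
  mul_one a := ext_heq (mul_one a.base) (elMul_one D.ω a.el)

instance : Category.{u} (Total D) where
  Hom a b := Σ f : a.base ⟶ b.base, D.Fib f a.el b.el
  id a := ⟨𝟙 a.base, D.id a.el⟩
  comp p q := ⟨p.1 ≫ q.1, D.comp p.2 q.2⟩
  id_comp p := Sigma.ext (Category.id_comp p.1) (D.id_comp p.2)
  comp_id p := Sigma.ext (Category.comp_id p.1) (D.comp_id p.2)
  assoc p q r := Sigma.ext (Category.assoc p.1 q.1 r.1) (D.comp_assoc p.2 q.2 r.2)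

/-- The morphism `(f, s)`. -/
def homMk {X Y : B} (f : X ⟶ Y) {x : El (D.ω X)} {y : El (D.ω Y)} (s : D.Fib f x y) :
    (⟨X, x⟩ : Total D) ⟶ ⟨Y, y⟩ := ⟨f, s⟩

theorem homMk_heq {X Y X' Y' : B} (hX : X = X') (hY : Y = Y') {f : X ⟶ Y} {f' : X' ⟶ Y'}
    (hf : HEq f f') {x : El (D.ω X)} {y : El (D.ω Y)} {x' : El (D.ω X')} {y' : El (D.ω Y')}
    (hx : HEq x x') (hy : HEq y y') {s : D.Fib f x y} {s' : D.Fib f' x' y'} (hs : HEq s s') :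
    HEq (homMk f s) (homMk f' s') := by
  subst hX hY; cases hf; cases hx; cases hy; cases hs; rfl

theorem eqToHom_eq {a b : Total D} (h : a = b) (h' : a.base = b.base) :
    ∃ e : D.Fib (eqToHom h') a.el b.el, eqToHom h = (⟨eqToHom h', e⟩ : Σ f, D.Fib f a.el b.el) := by
  subst h; exact ⟨D.id a.el, rfl⟩

instance : SSMC.{u} (Total D) where
  toCategory := inferInstance
  toMonoid := inferInstance
  tens p q := ⟨SSMC.tens p.1 q.1, D.tens p.2 q.2⟩
  braid a b := ⟨SSMC.braid a.base b.base, D.braid a.el b.el⟩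
  tens_id a b := Sigma.ext (SSMC.tens_id a.base b.base) (D.tens_id a.el b.el)
  tens_comp p q p' q' :=
    Sigma.ext (SSMC.tens_comp p.1 q.1 p'.1 q'.1) (D.tens_comp p.2 q.2 p'.2 q'.2)
  one_tens p := homMk_heq (one_mul _) (one_mul _) (SSMC.one_tens p.1) (one_elMul _ _)
    (one_elMul _ _) (D.one_tens p.2)
  tens_one p := homMk_heq (mul_one _) (mul_one _) (SSMC.tens_one p.1) (elMul_one _ _)
    (elMul_one _ _) (D.tens_one p.2)
  tens_assoc p q r := homMk_heq (mul_assoc _ _ _) (mul_assoc _ _ _) (SSMC.tens_assoc p.1 q.1 r.1)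
    (elMul_assoc _ _ _ _) (elMul_assoc _ _ _ _) (D.tens_assoc p.2 q.2 r.2)
  braid_natural p q := Sigma.ext (SSMC.braid_natural p.1 q.1) (D.braid_natural p.2 q.2)
  braid_braid a b := Sigma.ext (SSMC.braid_braid a.base b.base) (D.braid_braid a.el b.el)
  hexagon a b c := by
    obtain ⟨e, he⟩ := eqToHom_eq (mul_assoc b a c) (mul_assoc b.base a.base c.base)
    rw [he]
    exact homMk_heq (mul_assoc _ _ _).symm (mul_assoc _ _ _) (SSMC.hexagon _ _ _)
      (elMul_assoc _ _ _ _).symm (elMul_assoc _ _ _ _) (D.hexagon a.el b.el c.el e)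

/-- The projection `(X, x) ↦ X`, `(f, s) ↦ f`. -/
def proj (D : CoherentSpans B) : SSMFunctor (Total D) B where
  obj a := a.base
  map p := p.1
  obj_one := rfl
  obj_mul _ _ := rfl
  map_tens _ _ := HEq.rfl
  map_braid _ _ := HEq.rfl

end Total

/-- The functor `(X, x) ↦ (F X, x)`, `(f, s) ↦ (F f, s)`. -/
def pullbackFunctor (D : CoherentSpans B) (F : SSMFunctor A B) :
    SSMFunctor (Total (D.pullback F)) (Total D) where
  obj a := ⟨F.obj a.base, a.el⟩
  map p := ⟨F.map p.1, p.2⟩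
  map_id a := Sigma.ext (F.map_id a.base) (cast_heq _ _)
  map_comp p q := Sigma.ext (F.map_comp p.1 q.1) (cast_heq _ _)
  obj_one := Total.ext_heq F.obj_one (D.elOne_pullback F)
  obj_mul a b := Total.ext_heq (F.obj_mul a.base b.base) (D.elMul_pullback F a.el b.el)
  map_tens p q := Total.homMk_heq (F.obj_mul _ _) (F.obj_mul _ _) (F.map_tens p.1 q.1)
    (D.elMul_pullback F _ _) (D.elMul_pullback F _ _) (cast_heq _ _)
  map_braid a b := Total.homMk_heq (F.obj_mul _ _) (F.obj_mul _ _) (F.map_braid a.base b.base)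
    (D.elMul_pullback F _ _) (D.elMul_pullback F _ _) (cast_heq _ _)

/-- The lift `(X, x) ↦ (F X, x)`, `(f, s) ↦ (F f, s)` of a functor `F` to Grothendieck
constructions, if the sets and spans upstairs are those of `F X` and `F f`. -/
def lift {D' : CoherentSpans A} {D : CoherentSpans B} (F : SSMFunctor A B)
    (h : D' = D.pullback F) : SSMFunctor (Total D') (Total D) :=
  h ▸ D.pullbackFunctor F

/-! ### The net of a Grothendieck construction -/

section Gens

variable {P : PetriNet.{u}} (D : CoherentSpans P.Free)

/-- The places over the letters of a word `w` that are given by an element over `w`. -/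
noncomputable def decorate : ∀ w : List P.Place, El (D.ω (FreeMonoid.ofList w)) →
    List (Σ p : P.Place, El (D.ω (PetriNet.Free.of P p)))
  | [], _ => []
  | p :: w, x => ⟨p, (elSplit D.ω (PetriNet.Free.of P p) (FreeMonoid.ofList w) x).1⟩ ::
      decorate w (elSplit D.ω (PetriNet.Free.of P p) (FreeMonoid.ofList w) x).2

/-- The net underlying the Grothendieck construction: its places are the pairs `(p, x)` of a
place and an element of its set; its transitions over a transition `t` are the elements of the
apex of the span of `t`. -/
noncomputable def net : PetriNet.{u} where
  Place := Σ p : P.Place, El (D.ω (PetriNet.Free.of P p))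
  Trans := Σ t : P.Trans, Σ x : El (D.ω (P.src t)), Σ y : El (D.ω (P.tgt t)),
    D.Fib (PetriNet.Free.mk (PetriNet.Term.gen t)) x y
  src t := FreeMonoid.ofList (D.decorate (P.src t.1).toList t.2.1)
  tgt t := FreeMonoid.ofList (D.decorate (P.tgt t.1).toList t.2.2.1)

/-- The one-letter objects `(p, x)`. -/
def genObj (q : Σ p : P.Place, El (D.ω (PetriNet.Free.of P p))) : Total D :=
  ⟨PetriNet.Free.of P q.1, q.2⟩

theorem lift_decorate : ∀ (w : List P.Place) (x : El (D.ω (FreeMonoid.ofList w))),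
    FreeMonoid.lift D.genObj (FreeMonoid.ofList (D.decorate w x)) =
      ⟨FreeMonoid.ofList w, x⟩
  | [], x => Total.ext_heq rfl (by
      have : ∀ (A : SetWord.{u}) (_ : A = 1) (x y : El A), x = y := by rintro _ rfl _ _; rfl
      exact heq_of_eq (this _ (map_one D.ω) _ _))
  | p :: w, x => by
    have ih := lift_decorate w (elSplit D.ω (PetriNet.Free.of P p) (FreeMonoid.ofList w) x).2
    rw [decorate, FreeMonoid.ofList_cons, map_mul, ih, FreeMonoid.lift_eval_of]
    exact Total.ext_heq rfl (heq_of_eq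
      (elMul_elSplit D.ω (X := PetriNet.Free.of P p) (Y := FreeMonoid.ofList w) x))

/-- The generating objects and morphisms of the Grothendieck construction. -/
noncomputable def gens : D.net.Interp (Total D) where
  obj := D.genObj
  hom t := eqToHom (D.lift_decorate _ _) ≫
    Total.homMk (PetriNet.Free.mk (PetriNet.Term.gen t.1)) t.2.2.2 ≫
    eqToHom (D.lift_decorate _ _).symm

end Gens

end CoherentSpans

/-! ### Identifications -/

/-- The terminal strict symmetric monoidal category. -/
inductive Terminal : Type
  | pt

namespace Terminal

instance : Monoid Terminal where
  one := pt
  mul _ _ := pt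
  mul_assoc _ _ _ := rfl
  one_mul := by rintro ⟨⟩; rfl
  mul_one := by rintro ⟨⟩; rfl

instance : Category.{0} Terminal where
  Hom _ _ := Unit
  id _ := ()
  comp _ _ := ()

instance : SSMC.{0} Terminal where
  toCategory := inferInstance
  toMonoid := inferInstance
  tens _ _ := ()
  braid _ _ := ()
  tens_id _ _ := rfl
  tens_comp _ _ _ _ := rfl
  one_tens _ := HEq.rfl
  tens_one _ := HEq.rfl
  tens_assoc _ _ _ := HEq.rfl
  braid_natural _ _ := rfl
  braid_braid _ _ := rfl
  hexagon _ _ _ := HEq.rfl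

/-- The unique functor to the terminal category. -/
def from_ (C : Type u) [SSMC.{v} C] : SSMFunctor C Terminal where
  obj _ := pt
  map _ := ()
  obj_one := rfl
  obj_mul _ _ := rfl
  map_tens _ _ := HEq.rfl
  map_braid _ _ := HEq.rfl

end Terminal

/-- Let `O`, `A`, `B` be strict symmetric monoidal categories, `O` and `A` with generating objects
and morphisms `iO` and `iA`, and let `A` and `B` carry semantics `UA`, `UB` in `S`. The pair
`(B, UB)` is an identification of `(A, UA)` via `F` with witnesses `O`, `l`, `r`. -/
structure IsIdentification {R P : PetriNet.{u}} {O A B : Type u} [SSMC.{u} O] [SSMC.{u} A]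
    [SSMC.{u} B] (iO : R.Interp O) (iA : P.Interp A) {S : Type u₁} [SSMC.{v₁} S]
    (UA : SSMFunctor A S) (UB : SSMFunctor B S) (F : SSMFunctor A B) (l r : SSMFunctor O A) :
    Prop where
  /-- `F` is a morphism from `(A, UA)` to `(B, UB)` -/
  comp_eq : F.comp UB = UA
  left_preserving : PetriNet.TransitionPreserving iO iA l
  right_preserving : PetriNet.TransitionPreserving iO iA r
  equalizes : l.comp UA = r.comp UA
  isCoequalizer : IsCoequalizer l r F

/-- The internalization of a functor to sets and partial functions: the Grothendieck construction,
with objects `(X, x)`, `x ∈ G X`, and with the morphisms `f : X ⟶ Y` such that `G f (x) = y` as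
morphisms from `(X, x)` to `(Y, y)`. -/
abbrev SetS.Internalization {B : Type u} [SSMC.{u} B] (G : SSMFunctor B SetS.{u}) : Type u :=
  CoherentSpans.Total (CoherentSpans.ofSet G)

/-- The lift of a morphism `F : (A, UA) → (B, UB)` to internalizations. -/
def SetS.lift {A B : Type u} [SSMC.{u} A] [SSMC.{u} B] {UA : SSMFunctor A SetS.{u}}
    {UB : SSMFunctor B SetS.{u}} (F : SSMFunctor A B) (h : F.comp UB = UA) :
    SSMFunctor (SetS.Internalization UA) (SetS.Internalization UB) :=
  CoherentSpans.lift F (show CoherentSpans.ofSet UA = _ from h ▸ CoherentSpans.ofSet_comp F UB)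

/-! ### Families over a coherent system of spans -/

/-! For a coherent system of spans `D` on `B`, the projection of `Total D` to `B` has unique lifting
of factorizations: an element over `f ≫ g` is a composite in exactly one way (`comp_bijective`), an
element over a tensor product is a tensor product in exactly one way (`tens_bijective`), and
consequently the elements over identities and braidings are the canonical ones (`eq_id`,
`eq_braid`). This is the discrete Conduché condition, under which one can exponentiate along the
projection.

The exponential is built by hand. For a strict symmetric monoidal category `E`, the objects of
`Family D E` are an object `X` of `B` with a family of objects of `E` indexed by the elements over
`X`; its morphisms are a morphism `f` with a family of morphisms indexed by the span of `f`. Unique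
factorization is exactly what makes composition, tensor product and symmetry of such families well
defined. Functors from `Total D` to `E` are then the same as sections of the projection from `Family
D E` to `B`: `curry` and `uncurry` pass between them, by `curry_injective` and `curry_uncurry`. So
every universal property of `B` with respect to functors out of it is inherited by `Total D`.

Freeness (`gens_isFree`): an interpretation in `E` of the net of `D` amounts to an interpretation of
the original net in `Family D E` lying over the tautological one. It extends to a functor on the
free category; uniqueness of extensions makes this functor a section, and uncurrying gives the
required functor.

Coequalizers (`isCoequalizer_lift`): let `T` on `Total (D.pullback F)` equalize the lifts of `l` and
`r`. Currying `T` and regarding a family over `X` as a family over `F X` gives a functor from `A` to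
`Family D E` over `F`, which equalizes `l` and `r`. It factors through `F` by a functor that is
again a section by uniqueness, and uncurrying yields the factorization of `T`.

Transitions are preserved because an element over `σ ≫ g ≫ σ'` splits into elements over the three
factors, and elements over symmetries are symmetries (`isSymmetry_homMk`). Partial functions and
spans need no separate treatment: a partial function is the case in which each set `Fib f x y` has
at most one element. -/

theorem elMul_injective {B : Type u} [SSMC.{u} B] (ω : B →* SetWord.{u}) {X Y : B}
    {x x' : El (ω X)} {y y' : El (ω Y)} (h : elMul ω x y = elMul ω x' y') : x = x' ∧ y = y' :=
  Prod.mk.inj ((elMul_bijective ω X Y).1 (a₁ := (x, y)) (a₂ := (x', y')) h)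

theorem exists_elMul {B : Type u} [SSMC.{u} B] (ω : B →* SetWord.{u}) {X Y : B}
    (z : El (ω (X * Y))) : ∃ x y, z = elMul ω x y :=
  ⟨_, _, (elMul_elSplit ω z).symm⟩

theorem elSplit_elMul {B : Type u} [SSMC.{u} B] (ω : B →* SetWord.{u}) {X Y : B}
    (x : El (ω X)) (y : El (ω Y)) : elSplit ω X Y (elMul ω x y) = (x, y) :=
  (elSplit ω X Y).apply_symm_apply (x, y)

theorem eq_elOne {B : Type u} [SSMC.{u} B] (ω : B →* SetWord.{u}) (x : El (ω 1)) :
    x = elOne ω := by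
  -- The word `ω 1` is empty only up to a propositional equality, so the word is generalized before
  -- that equality is substituted.
  have : ∀ (A : SetWord.{u}) (_ : A = 1) (x y : El A), x = y := by rintro _ rfl _ _; rfl
  exact this _ (map_one ω) _ _

theorem SSMC.eqToHom_heq_id {C : Type u} [Category.{v} C] {X Y Z : C} (h : X = Y) (h' : X = Z) :
    HEq (eqToHom h) (𝟙 Z) := by
  subst h h'; rfl

namespace CoherentSpans

variable {A B : Type u} [SSMC.{u} A] [SSMC.{u} B]

/-! ### Factorization of elements of the spans -/

section Decompose

variable (D : CoherentSpans B)

/-- The surjective half of `comp_bijective`. It brings an arbitrary element over a composite into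
the form on which the operations of `D` and of families can be computed; `exists_tens` does the same
for tensor products. -/
theorem exists_comp {X Y Z : B} {f : X ⟶ Y} {g : Y ⟶ Z} {x : El (D.ω X)} {z : El (D.ω Z)}
    (r : D.Fib (f ≫ g) x z) : ∃ (y : El (D.ω Y)) (s : D.Fib f x y) (t : D.Fib g y z),
    r = D.comp s t := by
  obtain ⟨⟨y, s, t⟩, rfl⟩ := (D.comp_bijective f g x z).2 r
  exact ⟨y, s, t, rfl⟩

theorem exists_tens {X Y X' Y' : B} {f : X ⟶ Y} {g : X' ⟶ Y'} {x : El (D.ω X)} {y : El (D.ω Y)}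
    {x' : El (D.ω X')} {y' : El (D.ω Y')}
    (r : D.Fib (SSMC.tens f g) (elMul D.ω x x') (elMul D.ω y y')) :
    ∃ (s : D.Fib f x y) (t : D.Fib g x' y'), r = D.tens s t := by
  obtain ⟨⟨s, t⟩, rfl⟩ := (D.tens_bijective f g x y x' y').2 r
  exact ⟨s, t, rfl⟩

end Decompose

/-- An object `X` of the base together with a family of objects of `E` indexed by the elements
over `X`. -/
structure Family (D : CoherentSpans B) (E : Type u) where
  base : B
  fam : El (D.ω base) → E

namespace Family

variable {D : CoherentSpans B} {E : Type u}

theorem ext_heq {a b : Family D E} (h : a.base = b.base)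
    (h' : ∀ x y, HEq x y → a.fam x = b.fam y) : a = b := by
  obtain ⟨X, φ⟩ := a
  obtain ⟨Y, ψ⟩ := b
  cases h
  obtain rfl : φ = ψ := funext fun x => h' x x HEq.rfl
  rfl

variable [SSMC.{u} E]

/-- A morphism of the base together with a family of morphisms of `E` indexed by the elements of
its span. -/
structure Hom (a b : Family D E) where
  base : a.base ⟶ b.base
  app : ∀ {x : El (D.ω a.base)} {y : El (D.ω b.base)}, D.Fib base x y → (a.fam x ⟶ b.fam y)

/-- The monoidal axioms equate morphisms whose sources, targets and bases agree only
propositionally, so the indexing elements on the two sides have different types and are matched by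
heterogeneous equality. -/
theorem Hom.ext_heq {a b a' b' : Family D E} (ha : a = a') (hb : b = b') {p : Hom a b}
    {p' : Hom a' b'} (h : HEq p.base p'.base)
    (h' : ∀ {x x' y y'} (s : D.Fib p.base x y) (s' : D.Fib p'.base x' y'), HEq x x' → HEq y y' →
      HEq s s' → HEq (p.app s) (p'.app s')) : HEq p p' := by
  subst ha hb
  obtain ⟨f, α⟩ := p
  obtain ⟨g, β⟩ := p'
  cases h
  have : @α = @β := by
    funext x y s
    exact eq_of_heq (h' s s HEq.rfl HEq.rfl HEq.rfl)
  cases this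
  rfl

theorem Hom.ext_of_eq {a b : Family D E} {p p' : Hom a b} (h : p.base = p'.base)
    (h' : ∀ {x y} (s : D.Fib p.base x y) (s' : D.Fib p'.base x y), HEq s s' →
      p.app s = p'.app s') : p = p' :=
  eq_of_heq (Hom.ext_heq rfl rfl (heq_of_eq h) fun {x x' y y'} s s' hx hy hs => by
    cases hx; cases hy; exact heq_of_eq (h' s s' hs))

theorem Hom.app_heq {a b a' b' : Family D E} (ha : a = a') (hb : b = b') {p : Hom a b}
    {p' : Hom a' b'} (h : HEq p p') {x : El (D.ω a.base)} {y : El (D.ω b.base)}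
    {x' : El (D.ω a'.base)} {y' : El (D.ω b'.base)} (hx : HEq x x') (hy : HEq y y')
    {s : D.Fib p.base x y} {s' : D.Fib p'.base x' y'} (hs : HEq s s') :
    HEq (p.app s) (p'.app s') := by
  subst ha hb; cases h; cases hx; cases hy; cases hs; rfl

/-- By `eq_id` an element over an identity joins a point only to itself, so the identity of `E` is
available as its value. The heterogeneous equality determines the value and hides the transport
along `x = y`. -/
theorem id_exists (a : Family D E) {x y : El (D.ω a.base)} (r : D.Fib (𝟙 a.base) x y) :
    ∃ e : a.fam x ⟶ a.fam y, HEq e (𝟙 (a.fam x)) := by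
  obtain ⟨rfl, _⟩ := D.eq_id r
  exact ⟨𝟙 _, HEq.rfl⟩

/-- The value at `r` is computed from a factorization of `r` through some middle point: one exists
by surjectivity of `comp_bijective`, and its injectivity makes the value independent of the choice.
This is where families need spans that compose by exact pullback. -/
theorem comp_exists {a b c : Family D E} (p : Hom a b) (q : Hom b c) {x : El (D.ω a.base)}
    {z : El (D.ω c.base)} (r : D.Fib (p.base ≫ q.base) x z) :
    ∃ e : a.fam x ⟶ c.fam z, ∀ {y} (s : D.Fib p.base x y) (t : D.Fib q.base y z),
      D.comp s t = r → e = p.app s ≫ q.app t := by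
  obtain ⟨y, s, t, rfl⟩ := D.exists_comp r
  refine ⟨p.app s ≫ q.app t, fun {y'} s' t' h => ?_⟩
  cases (D.comp_bijective p.base q.base x z).1 (a₁ := ⟨y', s', t'⟩) (a₂ := ⟨y, s, t⟩) h
  rfl

/-- The identity of a family. -/
noncomputable def Hom.id (a : Family D E) : Hom a a :=
  ⟨𝟙 a.base, fun r => (a.id_exists r).choose⟩

/-- The composite of morphisms of families. -/
noncomputable def Hom.comp {a b c : Family D E} (p : Hom a b) (q : Hom b c) : Hom a c :=
  ⟨p.base ≫ q.base, fun r => (comp_exists p q r).choose⟩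

theorem Hom.app_id (a : Family D E) {x y : El (D.ω a.base)} (s : D.Fib (𝟙 a.base) x y) :
    HEq ((Hom.id a).app s) (𝟙 (a.fam x)) :=
  (a.id_exists s).choose_spec

theorem Hom.app_comp {a b c : Family D E} (p : Hom a b) (q : Hom b c) {x : El (D.ω a.base)}
    {y : El (D.ω b.base)} {z : El (D.ω c.base)} (s : D.Fib p.base x y) (t : D.Fib q.base y z) :
    (p.comp q).app (D.comp s t) = p.app s ≫ q.app t :=
  (comp_exists p q _).choose_spec s t rfl

/-- Each law is checked on elements that have been factored completely. The corresponding law of `D`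
identifies the two indexing elements, and the law of `E` then applies to the values. -/
noncomputable instance : Category.{u} (Family D E) where
  Hom := Hom
  id := Hom.id
  comp := Hom.comp
  id_comp {a b} p := by
    refine Hom.ext_of_eq (Category.id_comp p.base) fun {x y} r r' h => ?_
    obtain rfl := eq_of_heq (h.trans (D.id_comp r').symm)
    exact ((Hom.id a).app_comp p (D.id x) r').trans ((congrArg (· ≫ p.app r')
      (eq_of_heq (Hom.app_id a (D.id x)))).trans (Category.id_comp _))
  comp_id {a b} p := by
    refine Hom.ext_of_eq (Category.comp_id p.base) fun {x y} r r' h => ?_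
    obtain rfl := eq_of_heq (h.trans (D.comp_id r').symm)
    exact (p.app_comp (Hom.id b) r' (D.id y)).trans ((congrArg (p.app r' ≫ ·)
      (eq_of_heq (Hom.app_id b (D.id y)))).trans (Category.comp_id _))
  assoc {a b c d} p q r := by
    refine Hom.ext_of_eq (Category.assoc p.base q.base r.base) fun {x y} e e' h => ?_
    obtain ⟨z, s, k, rfl⟩ := D.exists_comp (f := p.base ≫ q.base) e
    obtain ⟨w, s, t, rfl⟩ := D.exists_comp s
    obtain rfl := eq_of_heq ((D.comp_assoc s t k).symm.trans h)
    refine ((p.comp q).app_comp r (D.comp s t) k).trans ((congrArg (· ≫ r.app k)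
      (p.app_comp q s t)).trans ((Category.assoc _ _ _).trans ?_))
    exact ((p.app_comp (q.comp r) s (D.comp t k)).trans (congrArg (p.app s ≫ ·)
      (q.app_comp r t k))).symm

theorem app_id (a : Family D E) {x y : El (D.ω a.base)} (s : D.Fib (𝟙 a.base) x y) :
    HEq ((𝟙 a : a ⟶ a).app s) (𝟙 (a.fam x)) :=
  Hom.app_id a s

theorem app_comp {a b c : Family D E} (p : a ⟶ b) (q : b ⟶ c) {x : El (D.ω a.base)}
    {y : El (D.ω b.base)} {z : El (D.ω c.base)} (s : D.Fib p.base x y) (t : D.Fib q.base y z) :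
    (p ≫ q).app (D.comp s t) = p.app s ≫ q.app t :=
  Hom.app_comp p q s t

theorem eqToHom_base {a b : Family D E} (h : a = b) :
    (eqToHom h).base = eqToHom (congrArg base h) := by
  subst h; rfl

theorem app_eqToHom {a b : Family D E} (h : a = b) {x : El (D.ω a.base)} {y : El (D.ω b.base)}
    (s : D.Fib (eqToHom h).base x y) : HEq ((eqToHom h).app s) (𝟙 (a.fam x)) := by
  subst h; exact a.app_id s

/-- The product is taken pointwise in `E` after an element over a product has been split into its
two parts. Associativity and the unit laws thus combine those of `E` with those of concatenation of
elements. -/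
noncomputable instance : Monoid (Family D E) where
  mul a b := ⟨a.base * b.base, fun z => a.fam (elSplit D.ω _ _ z).1 * b.fam (elSplit D.ω _ _ z).2⟩
  one := ⟨1, fun _ => 1⟩
  mul_assoc a b c := by
    refine ext_heq (mul_assoc a.base b.base c.base) fun z z' h => ?_
    obtain ⟨w, z, rfl⟩ := exists_elMul D.ω z
    obtain ⟨x, y, rfl⟩ := exists_elMul D.ω w
    obtain rfl := eq_of_heq ((elMul_assoc D.ω x y z).symm.trans h)
    change (a.fam (elSplit D.ω _ _ (elSplit D.ω _ _ (elMul D.ω (elMul D.ω x y) z)).1).1 *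
      b.fam (elSplit D.ω _ _ (elSplit D.ω _ _ (elMul D.ω (elMul D.ω x y) z)).1).2) *
      c.fam (elSplit D.ω _ _ (elMul D.ω (elMul D.ω x y) z)).2 =
      a.fam (elSplit D.ω _ _ (elMul D.ω x (elMul D.ω y z))).1 *
      (b.fam (elSplit D.ω _ _ (elSplit D.ω _ _ (elMul D.ω x (elMul D.ω y z))).2).1 *
      c.fam (elSplit D.ω _ _ (elSplit D.ω _ _ (elMul D.ω x (elMul D.ω y z))).2).2)
    simp only [elSplit_elMul, mul_assoc]
  one_mul a := by
    refine ext_heq (one_mul a.base) fun z z' h => ?_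
    obtain rfl := eq_of_heq (h.trans (one_elMul D.ω z').symm)
    change 1 * a.fam (elSplit D.ω _ _ (elMul D.ω (elOne D.ω) z')).2 = a.fam z'
    rw [elSplit_elMul, one_mul]
  mul_one a := by
    refine ext_heq (mul_one a.base) fun z z' h => ?_
    obtain rfl := eq_of_heq (h.trans (elMul_one D.ω z').symm)
    change a.fam (elSplit D.ω _ _ (elMul D.ω z' (elOne D.ω))).1 * 1 = a.fam z'
    rw [elSplit_elMul, mul_one]

/-- Splitting undoes concatenation only propositionally, so this equation is not definitional. It is
the source of the transports in the tensor product and the symmetry of families, and of the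
heterogeneous equalities below. -/
theorem fam_mul (a b : Family D E) (x : El (D.ω a.base)) (y : El (D.ω b.base)) :
    (a * b).fam (elMul D.ω x y) = a.fam x * b.fam y := by
  change a.fam (elSplit D.ω _ _ (elMul D.ω x y)).1 * b.fam (elSplit D.ω _ _ (elMul D.ω x y)).2 = _
  rw [elSplit_elMul]

/-- The analogue of `comp_exists`: `z`, `w` and `r` each split uniquely, by `elMul_bijective` and
`tens_bijective`. The end points must be arbitrary for the result to define a morphism of families,
hence the quantification over all splittings. -/
theorem tens_exists {a b a' b' : Family D E} (p : Hom a b) (q : Hom a' b')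
    {z : El (D.ω (a.base * a'.base))} {w : El (D.ω (b.base * b'.base))}
    (r : D.Fib (SSMC.tens p.base q.base) z w) :
    ∃ e : (a * a').fam z ⟶ (b * b').fam w, ∀ {x x' y y'} (s : D.Fib p.base x y)
      (t : D.Fib q.base x' y'), elMul D.ω x x' = z → elMul D.ω y y' = w →
      HEq (D.tens s t) r → HEq e (SSMC.tens (p.app s) (q.app t)) := by
  obtain ⟨x, x', rfl⟩ := exists_elMul D.ω z
  obtain ⟨y, y', rfl⟩ := exists_elMul D.ω w
  obtain ⟨s, t, rfl⟩ := D.exists_tens r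
  refine ⟨eqToHom (fam_mul a a' x x') ≫ SSMC.tens (p.app s) (q.app t) ≫
    eqToHom (fam_mul b b' y y').symm, fun {x₁ x₁' y₁ y₁'} s₁ t₁ hx hy h => ?_⟩
  obtain ⟨rfl, rfl⟩ := elMul_injective D.ω hx
  obtain ⟨rfl, rfl⟩ := elMul_injective D.ω hy
  cases (D.tens_bijective _ _ _ _ _ _).1 (a₁ := (s₁, t₁)) (a₂ := (s, t)) (eq_of_heq h)
  exact SSMC.conj_heq _ _ _

/-- By `eq_braid` the starting point determines both the end point and the element itself, so `r`
carries no further data and the symmetry of `E` is the only value to prescribe. -/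
theorem braid_exists (a b : Family D E) {z : El (D.ω (a.base * b.base))}
    {w : El (D.ω (b.base * a.base))} (r : D.Fib (SSMC.braid a.base b.base) z w) :
    ∃ e : (a * b).fam z ⟶ (b * a).fam w, ∀ {x y}, elMul D.ω x y = z →
      HEq e (SSMC.braid (a.fam x) (b.fam y)) := by
  obtain ⟨x, y, rfl⟩ := exists_elMul D.ω z
  obtain ⟨rfl, -⟩ := D.eq_braid r
  refine ⟨eqToHom (fam_mul a b x y) ≫ SSMC.braid (a.fam x) (b.fam y) ≫
    eqToHom (fam_mul b a y x).symm, fun {x₁ y₁} h => ?_⟩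
  obtain ⟨rfl, rfl⟩ := elMul_injective D.ω h
  exact SSMC.conj_heq _ _ _

/-- The tensor product of morphisms of families. -/
noncomputable def tens {a b a' b' : Family D E} (p : a ⟶ b) (q : a' ⟶ b') : a * a' ⟶ b * b' :=
  Hom.mk (a := a * a') (b := b * b') (SSMC.tens p.base q.base) fun r => (tens_exists p q r).choose

/-- The symmetry of families. -/
noncomputable def braid (a b : Family D E) : a * b ⟶ b * a :=
  Hom.mk (a := a * b) (b := b * a) (SSMC.braid a.base b.base) fun r => (braid_exists a b r).choose

theorem app_tens {a b a' b' : Family D E} (p : a ⟶ b) (q : a' ⟶ b') {x : El (D.ω a.base)}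
    {y : El (D.ω b.base)} {x' : El (D.ω a'.base)} {y' : El (D.ω b'.base)}
    (s : D.Fib p.base x y) (t : D.Fib q.base x' y') :
    HEq ((tens p q).app (D.tens s t)) (SSMC.tens (p.app s) (q.app t)) :=
  (tens_exists p q (D.tens s t)).choose_spec s t rfl rfl HEq.rfl

theorem app_braid (a b : Family D E) (x : El (D.ω a.base)) (y : El (D.ω b.base)) :
    HEq ((braid a b).app (D.braid x y)) (SSMC.braid (a.fam x) (b.fam y)) :=
  (braid_exists a b (D.braid x y)).choose_spec rfl

/-- By `eq_id` only the elements `D.id x` can occur over an identity, so it suffices to compare with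
the identity there. -/
theorem id_ext {a : Family D E} {p : a ⟶ a} (h : p.base = 𝟙 a.base)
    (h' : ∀ x (s : D.Fib p.base x x), HEq s (D.id x) → HEq (p.app s) (𝟙 (a.fam x))) :
    p = 𝟙 a := by
  refine Hom.ext_of_eq h fun {x y} s s' hs => ?_
  obtain ⟨rfl, hs'⟩ := D.eq_id s'
  exact eq_of_heq ((h' x s (hs.trans hs')).trans (a.app_id s').symm)

/-! ### The axioms of a strict symmetric monoidal category for families -/

theorem tens_id (a b : Family D E) : tens (𝟙 a) (𝟙 b) = 𝟙 (a * b) := by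
  refine id_ext (SSMC.tens_id _ _) fun z s hs => ?_
  obtain ⟨x, y, rfl⟩ := exists_elMul D.ω z
  obtain rfl := eq_of_heq (hs.trans (D.tens_id x y).symm)
  refine (app_tens (𝟙 a) (𝟙 b) (D.id x) (D.id y)).trans ?_
  refine (SSMC.tens_heq_tens rfl rfl rfl rfl (a.app_id (D.id x)) (b.app_id (D.id y))).trans ?_
  rw [SSMC.tens_id, fam_mul]

theorem tens_comp {a b c a' b' c' : Family D E} (p : a ⟶ b) (q : b ⟶ c) (p' : a' ⟶ b')
    (q' : b' ⟶ c') : tens (p ≫ q) (p' ≫ q') = tens p p' ≫ tens q q' := by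
  refine Hom.ext_of_eq (SSMC.tens_comp _ _ _ _) fun {x z} r r' h => ?_
  obtain ⟨x, x', rfl⟩ := exists_elMul D.ω x
  obtain ⟨z, z', rfl⟩ := exists_elMul D.ω z
  obtain ⟨s, s', rfl⟩ := D.exists_tens r
  obtain ⟨y, s, t, rfl⟩ := D.exists_comp s
  obtain ⟨y', s', t', rfl⟩ := D.exists_comp s'
  obtain rfl := eq_of_heq ((D.tens_comp s t s' t').symm.trans h)
  apply eq_of_heq
  refine (app_tens _ _ _ _).trans ?_
  rw [app_comp, app_comp, SSMC.tens_comp]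
  refine HEq.trans ?_ (heq_of_eq (app_comp (tens p p') (tens q q') _ _).symm)
  exact (SSMC.comp_heq_comp (fam_mul _ _ _ _) (fam_mul _ _ _ _) (fam_mul _ _ _ _)
    (app_tens _ _ _ _) (app_tens _ _ _ _)).symm

theorem one_tens {a b : Family D E} (p : a ⟶ b) : HEq (tens (𝟙 1) p) p := by
  refine Hom.ext_heq (one_mul a) (one_mul b) (SSMC.one_tens p.base)
    fun {x x' y y'} s s' hx hy hs => ?_
  obtain rfl := eq_of_heq (hx.trans (one_elMul D.ω x').symm)
  obtain rfl := eq_of_heq (hy.trans (one_elMul D.ω y').symm)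
  obtain rfl := eq_of_heq (hs.trans (D.one_tens s').symm)
  refine (app_tens (𝟙 1) p (D.id _) s').trans ?_
  exact (SSMC.tens_heq_tens rfl rfl rfl rfl (app_id 1 (D.id _)) HEq.rfl).trans (SSMC.one_tens _)

theorem tens_one {a b : Family D E} (p : a ⟶ b) : HEq (tens p (𝟙 1)) p := by
  refine Hom.ext_heq (mul_one a) (mul_one b) (SSMC.tens_one p.base)
    fun {x x' y y'} s s' hx hy hs => ?_
  obtain rfl := eq_of_heq (hx.trans (elMul_one D.ω x').symm)
  obtain rfl := eq_of_heq (hy.trans (elMul_one D.ω y').symm)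
  obtain rfl := eq_of_heq (hs.trans (D.tens_one s').symm)
  refine (app_tens p (𝟙 1) s' (D.id _)).trans ?_
  exact (SSMC.tens_heq_tens rfl rfl rfl rfl HEq.rfl (app_id 1 (D.id _))).trans (SSMC.tens_one _)

theorem tens_assoc {a b a' b' a'' b'' : Family D E} (p : a ⟶ b) (q : a' ⟶ b') (r : a'' ⟶ b'') :
    HEq (tens (tens p q) r) (tens p (tens q r)) := by
  refine Hom.ext_heq (mul_assoc _ _ _) (mul_assoc _ _ _) (SSMC.tens_assoc _ _ _)
    fun {x z y w} s s' hx hy hs => ?_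
  obtain ⟨x, x'', rfl⟩ := exists_elMul D.ω x
  obtain ⟨x, x', rfl⟩ := exists_elMul D.ω x
  obtain ⟨y, y'', rfl⟩ := exists_elMul D.ω y
  obtain ⟨y, y', rfl⟩ := exists_elMul D.ω y
  obtain ⟨s, k, rfl⟩ := D.exists_tens s
  obtain ⟨s, t, rfl⟩ := D.exists_tens s
  obtain rfl := eq_of_heq ((elMul_assoc D.ω _ _ _).symm.trans hx)
  obtain rfl := eq_of_heq ((elMul_assoc D.ω _ _ _).symm.trans hy)
  obtain rfl := eq_of_heq ((D.tens_assoc _ _ _).symm.trans hs)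
  refine (app_tens (tens p q) r (D.tens s t) k).trans ?_
  refine (SSMC.tens_heq_tens (fam_mul _ _ _ _) (fam_mul _ _ _ _) rfl rfl
    (app_tens _ _ _ _) HEq.rfl).trans ?_
  refine (SSMC.tens_assoc _ _ _).trans ?_
  refine HEq.trans ?_ (app_tens p (tens q r) s (D.tens t k)).symm
  exact (SSMC.tens_heq_tens rfl rfl (fam_mul _ _ _ _) (fam_mul _ _ _ _) HEq.rfl
    (app_tens _ _ _ _)).symm

theorem braid_natural {a b a' b' : Family D E} (p : a ⟶ b) (q : a' ⟶ b') :
    tens p q ≫ braid b b' = braid a a' ≫ tens q p := by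
  refine Hom.ext_of_eq (SSMC.braid_natural _ _) fun {x z} r r' h => ?_
  obtain ⟨x, x', rfl⟩ := exists_elMul D.ω x
  obtain ⟨w, r, k, rfl⟩ := D.exists_comp (f := SSMC.tens p.base q.base)
    (g := SSMC.braid b.base b'.base) r
  obtain ⟨y, y', rfl⟩ := exists_elMul D.ω w
  obtain ⟨s, t, rfl⟩ := D.exists_tens r
  obtain ⟨rfl, hk⟩ := D.eq_braid k
  obtain rfl := eq_of_heq hk
  obtain rfl := eq_of_heq ((D.braid_natural s t).symm.trans h)
  refine (app_comp (tens p q) (braid b b') _ _).trans (Eq.trans (eq_of_heq ?_)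
    (app_comp (braid a a') (tens q p) _ _).symm)
  refine (SSMC.comp_heq_comp (fam_mul _ _ _ _) (fam_mul _ _ _ _) (fam_mul _ _ _ _)
    (app_tens _ _ _ _) (app_braid _ _ _ _)).trans ?_
  rw [SSMC.braid_natural]
  exact (SSMC.comp_heq_comp (fam_mul _ _ _ _) (fam_mul _ _ _ _) (fam_mul _ _ _ _)
    (app_braid _ _ _ _) (app_tens _ _ _ _)).symm

theorem braid_braid (a b : Family D E) : braid a b ≫ braid b a = 𝟙 (a * b) := by
  refine id_ext (SSMC.braid_braid _ _) fun z s hs => ?_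
  obtain ⟨x, y, rfl⟩ := exists_elMul D.ω z
  obtain rfl := eq_of_heq (hs.trans (D.braid_braid x y).symm)
  refine (heq_of_eq (app_comp (braid a b) (braid b a) _ _)).trans ?_
  refine (SSMC.comp_heq_comp (fam_mul _ _ _ _) (fam_mul _ _ _ _) (fam_mul _ _ _ _)
    (app_braid _ _ _ _) (app_braid _ _ _ _)).trans ?_
  rw [SSMC.braid_braid, fam_mul]

/-- The hexagon of `D` is formulated relative to an element over the associativity equality; this
supplies one. -/
theorem exists_fib_eqToHom {a b : Family D E} (h : a = b) {x : El (D.ω a.base)}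
    {y : El (D.ω b.base)} (hxy : HEq x y) : Nonempty (D.Fib (eqToHom h).base x y) := by
  subst h; cases hxy; exact ⟨D.id x⟩

theorem hexagon (a b c : Family D E) : HEq (braid a (b * c))
    (tens (braid a b) (𝟙 c) ≫ eqToHom (mul_assoc b a c) ≫ tens (𝟙 b) (braid a c)) := by
  have hq := eqToHom_base (mul_assoc b a c)
  refine Hom.ext_heq (mul_assoc _ _ _).symm (mul_assoc _ _ _)
    ((SSMC.hexagon a.base b.base c.base).trans (heq_of_eq ?_)) fun {w w' v v'} s s' hw hv hs => ?_
  · exact congrArg (fun k => SSMC.tens (SSMC.braid a.base b.base) (𝟙 c.base) ≫ k ≫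
      SSMC.tens (𝟙 b.base) (SSMC.braid a.base c.base)) hq.symm
  obtain ⟨x, w, rfl⟩ := exists_elMul D.ω w
  obtain ⟨y, z, rfl⟩ := exists_elMul D.ω w
  obtain ⟨rfl, h⟩ := D.eq_braid s
  obtain rfl := eq_of_heq h
  obtain rfl := eq_of_heq ((elMul_assoc D.ω x y z).trans hw)
  obtain rfl := eq_of_heq ((elMul_assoc D.ω y z x).symm.trans hv)
  obtain ⟨e⟩ := exists_fib_eqToHom (mul_assoc b a c) (elMul_assoc D.ω y x z)
  -- The hexagon of `D` takes an element over the equality morphism of `B`, while `e` lies over the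
  -- base of the equality morphism of families. The two morphisms agree by `hq`, which accounts for
  -- the cast.
  have he : HEq s' (D.comp (D.tens (D.braid x y) (D.id z))
      (D.comp e (D.tens (D.id y) (D.braid x z)))) := by
    refine hs.symm.trans ((D.hexagon x y z (cast (D.fib_congr rfl rfl (heq_of_eq hq) HEq.rfl
      HEq.rfl) e)).trans ?_)
    exact D.comp_heq rfl rfl rfl HEq.rfl (heq_of_eq (congrArg (· ≫ _) hq.symm)) HEq.rfl HEq.rfl
      HEq.rfl HEq.rfl (D.comp_heq rfl rfl rfl (heq_of_eq hq.symm) HEq.rfl HEq.rfl HEq.rfl HEq.rfl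
        (cast_heq _ _) HEq.rfl)
  obtain rfl := eq_of_heq he
  refine (app_braid a (b * c) x (elMul D.ω y z)).trans ((SSMC.braid_heq_braid rfl
    (fam_mul _ _ _ _)).trans ((SSMC.hexagon _ _ _).trans ?_))
  refine HEq.symm ((heq_of_eq (app_comp (tens (braid a b) (𝟙 c)) _ _ _)).trans ?_)
  have h₁ : ((b * a) * c).fam (elMul D.ω (elMul D.ω y x) z) = (b.fam y * a.fam x) * c.fam z := by
    rw [fam_mul, fam_mul]
  have h₂ : (b * (a * c)).fam (elMul D.ω y (elMul D.ω x z)) = b.fam y * (a.fam x * c.fam z) := by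
    rw [fam_mul, fam_mul]
  have h₃ : (b * (c * a)).fam (elMul D.ω y (elMul D.ω z x)) = b.fam y * (c.fam z * a.fam x) := by
    rw [fam_mul, fam_mul]
  have h₄ : ((a * b) * c).fam (elMul D.ω (elMul D.ω x y) z) = (a.fam x * b.fam y) * c.fam z := by
    rw [fam_mul, fam_mul]
  refine SSMC.comp_heq_comp h₄ h₁ h₃ ?_ ?_
  · exact (app_tens _ _ _ _).trans (SSMC.tens_heq_tens (fam_mul _ _ _ _) (fam_mul _ _ _ _) rfl rfl
      (app_braid _ _ _ _) (app_id _ _))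
  refine (heq_of_eq (app_comp (eqToHom (mul_assoc b a c)) (tens (𝟙 b) (braid a c)) e _)).trans ?_
  refine SSMC.comp_heq_comp h₁ h₂ h₃ ?_ ?_
  · exact (app_eqToHom _ e).trans (SSMC.eqToHom_heq_id _ h₁.symm).symm
  · exact (app_tens _ _ _ _).trans (SSMC.tens_heq_tens rfl rfl (fam_mul _ _ _ _) (fam_mul _ _ _ _)
      (app_id _ _) (app_braid _ _ _ _))

noncomputable instance : SSMC.{u} (Family D E) where
  toCategory := inferInstance
  toMonoid := inferInstance
  tens := tens
  braid := braid
  tens_id := tens_id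
  tens_comp := tens_comp
  one_tens := one_tens
  tens_one := tens_one
  tens_assoc := tens_assoc
  braid_natural := braid_natural
  braid_braid := braid_braid
  hexagon := hexagon

variable (D E) in
/-- The projection to the base. -/
def proj : SSMFunctor (Family D E) B where
  obj a := a.base
  map p := p.base
  obj_one := rfl
  obj_mul _ _ := rfl
  map_tens _ _ := HEq.rfl
  map_braid _ _ := HEq.rfl

end Family

end CoherentSpans

/-! ### Extensionality of strict functors -/

namespace SSMFunctor

variable {C : Type u₁} [SSMC.{v₁} C] {D : Type u₂} [SSMC.{v₂} D]

theorem ext_heq {F G : SSMFunctor C D} (h : ∀ X, F.obj X = G.obj X)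
    (h' : ∀ {X Y : C} (f : X ⟶ Y), HEq (F.map f) (G.map f)) : F = G := by
  have : F.toFunctor = G.toFunctor := Functor.hext h fun _ _ f => h' f
  cases F; cases G; congr

theorem map_heq_of_eq {F G : SSMFunctor C D} (h : F = G) {X Y X' Y' : C} (hX : X = X')
    (hY : Y = Y') {f : X ⟶ Y} {g : X' ⟶ Y'} (hf : HEq f g) : HEq (F.map f) (G.map g) := by
  subst h hX hY; cases hf; rfl

theorem obj_congr {F G : SSMFunctor C D} (h : F = G) (X : C) : F.obj X = G.obj X := by rw [h]

variable (C) in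
/-- The identity functor. -/
def id : SSMFunctor C C where
  toFunctor := 𝟭 C
  obj_one := rfl
  obj_mul _ _ := rfl
  map_tens _ _ := HEq.rfl
  map_braid _ _ := HEq.rfl

end SSMFunctor

namespace CoherentSpans

variable {A B O : Type u} [SSMC.{u} A] [SSMC.{u} B] [SSMC.{u} O]

theorem el_congr (D : CoherentSpans B) {X Y : B} (h : X = Y) : El (D.ω X) = El (D.ω Y) := by
  rw [h]

/-! ### Functors on a Grothendieck construction as sections of families -/

namespace Family

variable {D : CoherentSpans B} {E : Type u}

theorem fam_congr {a b : Family D E} (h : a = b) {x : El (D.ω a.base)} {y : El (D.ω b.base)}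
    (hxy : HEq x y) : a.fam x = b.fam y := by
  subst h; cases hxy; rfl

variable [SSMC.{u} E]

/-- The family of the values of a functor on a Grothendieck construction at the elements over a
fixed object. -/
def values (H : SSMFunctor (Total D) E) (X : B) : Family D E := ⟨X, fun x => H.obj ⟨X, x⟩⟩

/-- The family of the values of a functor on a Grothendieck construction at the elements of the
span of a fixed morphism. -/
def valuesMap (H : SSMFunctor (Total D) E) {X Y : B} (f : X ⟶ Y) : values H X ⟶ values H Y :=
  Hom.mk (a := values H X) (b := values H Y) f fun s => H.map (Total.homMk f s)

theorem values_mul (H : SSMFunctor (Total D) E) (X Y : B) :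
    values H (X * Y) = values H X * values H Y :=
  ext_heq rfl fun z z' h => by
    obtain rfl := eq_of_heq h
    obtain ⟨x, y, rfl⟩ := exists_elMul D.ω z
    exact (H.obj_mul ⟨X, x⟩ ⟨Y, y⟩).trans (fam_mul (values H X) (values H Y) x y).symm

/-- The functor to families that corresponds to a functor on a Grothendieck construction. -/
def curry (H : SSMFunctor (Total D) E) : SSMFunctor B (Family D E) where
  obj := values H
  map := valuesMap H
  map_id X := id_ext rfl fun x s hs => by
    obtain rfl := eq_of_heq hs
    exact heq_of_eq (H.map_id ⟨X, x⟩)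
  map_comp {X Y Z} f g := Hom.ext_of_eq rfl fun {x z} r r' h => by
    obtain rfl := eq_of_heq h
    obtain ⟨y, s, t, rfl⟩ := D.exists_comp (f := f) (g := g) r
    exact (H.map_comp (Total.homMk f s) (Total.homMk g t)).trans
      (app_comp (valuesMap H f) (valuesMap H g) s t).symm
  obj_one := ext_heq rfl fun x y _ => by
    obtain rfl := eq_elOne D.ω x
    exact H.obj_one
  obj_mul := values_mul H
  map_tens {X Y X' Y'} f g := by
    refine Hom.ext_heq (values_mul H _ _) (values_mul H _ _) HEq.rfl
      fun {z z' w w'} r r' hz hw hr => ?_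
    obtain rfl := eq_of_heq hz
    obtain rfl := eq_of_heq hw
    obtain rfl := eq_of_heq hr
    obtain ⟨x, x', rfl⟩ := exists_elMul D.ω z
    obtain ⟨y, y', rfl⟩ := exists_elMul D.ω w
    obtain ⟨s, t, rfl⟩ := D.exists_tens r
    exact (H.map_tens (Total.homMk f s) (Total.homMk g t)).trans
      (app_tens (valuesMap H f) (valuesMap H g) s t).symm
  map_braid X Y := by
    refine Hom.ext_heq (values_mul H _ _) (values_mul H _ _) HEq.rfl
      fun {z z' w w'} r r' hz hw hr => ?_
    obtain rfl := eq_of_heq hz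
    obtain rfl := eq_of_heq hw
    obtain rfl := eq_of_heq hr
    obtain ⟨x, y, rfl⟩ := exists_elMul D.ω z
    obtain ⟨rfl, hr⟩ := D.eq_braid r
    obtain rfl := eq_of_heq hr
    exact (H.map_braid ⟨X, x⟩ ⟨Y, y⟩).trans (app_braid (values H X) (values H Y) x y).symm

theorem map_heq_of_curry_eq {H H' : SSMFunctor (Total D) E} (h : curry H = curry H') {X Y : B}
    (f : X ⟶ Y) {x : El (D.ω X)} {y : El (D.ω Y)} (s : D.Fib f x y) :
    HEq (H.map (Total.homMk f s)) (H'.map (Total.homMk f s)) :=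
  Hom.app_heq (SSMFunctor.obj_congr h X) (SSMFunctor.obj_congr h Y)
    (SSMFunctor.map_heq_of_eq h rfl rfl (HEq.refl f)) HEq.rfl HEq.rfl (HEq.refl s)

/-- Every object and every morphism of `Total D` lies over something in `B`, so all values of a
functor can be read off from its families. -/
theorem curry_injective : Function.Injective (curry (D := D) (E := E)) := fun _ _ h =>
  SSMFunctor.ext_heq (fun a => fam_congr (SSMFunctor.obj_congr h a.base) (HEq.refl a.el))
    fun p => map_heq_of_curry_eq h p.1 p.2

section Uncurry

variable (K : SSMFunctor B (Family D E)) (hK : K.comp (proj D E) = SSMFunctor.id B)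

-- A section satisfies its equation as an equality of functors, so the base of `K.obj X` is `X` only
-- propositionally. The casts in `uncurry` are transports along this equation and along `base_map`.
include hK in
theorem base_obj (X : B) : (K.obj X).base = X := SSMFunctor.obj_congr hK X

include hK in
theorem base_map {X Y : B} (f : X ⟶ Y) : HEq (K.map f).base f :=
  SSMFunctor.map_heq_of_eq hK rfl rfl (HEq.refl f)

end Uncurry

/-- The functor on the Grothendieck construction whose values are the members of the families
given by a section of the projection. -/
def uncurry (K : SSMFunctor B (Family D E)) (hK : K.comp (proj D E) = SSMFunctor.id B) :
    SSMFunctor (Total D) E where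
  obj a := (K.obj a.base).fam (cast (D.el_congr (base_obj K hK a.base).symm) a.el)
  map {a b} p := (K.map p.1).app (cast (D.fib_congr (base_obj K hK _).symm (base_obj K hK _).symm
    (base_map K hK p.1).symm (cast_heq _ _).symm (cast_heq _ _).symm) p.2)
  map_id a := eq_of_heq <| (Hom.app_heq rfl rfl (heq_of_eq (K.map_id a.base)) HEq.rfl HEq.rfl
    ((cast_heq _ _).trans (D.id_heq (base_obj K hK _).symm (cast_heq _ _).symm))).trans
      (app_id _ (D.id _))
  map_comp {a b c} p q := by
    refine eq_of_heq <| (Hom.app_heq rfl rfl (heq_of_eq (K.map_comp p.1 q.1)) HEq.rfl HEq.rfl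
      ((cast_heq _ _).trans (D.comp_heq (base_obj K hK _).symm (base_obj K hK _).symm
        (base_obj K hK _).symm (base_map K hK _).symm (base_map K hK _).symm (cast_heq _ _).symm
        (cast_heq _ _).symm (cast_heq _ _).symm (cast_heq _ _).symm (cast_heq _ _).symm))).trans
      (heq_of_eq (app_comp _ _ _ _))
  obj_one := fam_congr K.obj_one (cast_heq _ _)
  obj_mul a b := (fam_congr (K.obj_mul a.base b.base) ((cast_heq _ _).trans
    (D.elMul_heq (base_obj K hK _).symm (base_obj K hK _).symm (cast_heq _ _).symm
      (cast_heq _ _).symm))).trans (fam_mul _ _ _ _)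
  map_tens {a b a' b'} p q := (Hom.app_heq (K.obj_mul _ _) (K.obj_mul _ _) (K.map_tens p.1 q.1)
    ((cast_heq _ _).trans (D.elMul_heq (base_obj K hK _).symm (base_obj K hK _).symm
      (cast_heq _ _).symm (cast_heq _ _).symm))
    ((cast_heq _ _).trans (D.elMul_heq (base_obj K hK _).symm (base_obj K hK _).symm
      (cast_heq _ _).symm (cast_heq _ _).symm))
    ((cast_heq _ _).trans (D.tens_heq (base_obj K hK _).symm (base_obj K hK _).symm
      (base_obj K hK _).symm (base_obj K hK _).symm (base_map K hK _).symm (base_map K hK _).symm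
      (cast_heq _ _).symm (cast_heq _ _).symm (cast_heq _ _).symm (cast_heq _ _).symm
      (cast_heq _ _).symm (cast_heq _ _).symm))).trans (app_tens _ _ _ _)
  map_braid a b := (Hom.app_heq (K.obj_mul _ _) (K.obj_mul _ _) (K.map_braid a.base b.base)
    ((cast_heq _ _).trans (D.elMul_heq (base_obj K hK _).symm (base_obj K hK _).symm
      (cast_heq _ _).symm (cast_heq _ _).symm))
    ((cast_heq _ _).trans (D.elMul_heq (base_obj K hK _).symm (base_obj K hK _).symm
      (cast_heq _ _).symm (cast_heq _ _).symm))
    ((cast_heq _ _).trans (D.braid_heq (base_obj K hK _).symm (base_obj K hK _).symm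
      (cast_heq _ _).symm (cast_heq _ _).symm))).trans (app_braid _ _ _ _)

/-- Together with `curry_injective` this makes currying a bijection from functors on `Total D` to
sections of the projection from families, which is how universal properties are transferred from
`B`. -/
theorem curry_uncurry (K : SSMFunctor B (Family D E))
    (hK : K.comp (proj D E) = SSMFunctor.id B) : curry (uncurry K hK) = K := by
  have ho (X : B) : (curry (uncurry K hK)).obj X = K.obj X :=
    ext_heq (base_obj K hK X).symm fun x y h =>
      congrArg (K.obj X).fam (eq_of_heq ((cast_heq _ _).trans h))
  refine SSMFunctor.ext_heq ho fun {X Y} f => Hom.ext_heq (ho X) (ho Y) (base_map K hK f).symm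
    fun {x x' y y'} s s' hx hy hs => ?_
  exact Hom.app_heq rfl rfl HEq.rfl ((cast_heq _ _).trans hx) ((cast_heq _ _).trans hy)
    ((cast_heq _ _).trans hs)

end Family

end CoherentSpans

/-! ### Equality morphisms around generators -/

theorem IsSymmetry.eqToHom {C : Type u} [SSMC.{v} C] {X Y : C} (h : X = Y) :
    IsSymmetry (eqToHom h) := by
  subst h; exact IsSymmetry.id X

theorem PetriNet.Interp.map_comp {P : PetriNet.{u}} {C : Type u₁} [SSMC.{v₁} C] {D : Type u₂}
    [SSMC.{v₂} D] {E : Type u₃} [SSMC.{v₃} E] (i : P.Interp C) (F : SSMFunctor C D)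
    (G : SSMFunctor D E) : i.map (F.comp G) = (i.map F).map G :=
  PetriNet.Interp.ext_of_heq rfl fun t => (SSMC.conj_heq _ _ _).trans (HEq.symm
    ((SSMC.conj_heq _ _ (G.map ((i.map F).hom t))).trans
      (PetriNet.map_conj_heq G _ _ (F.map (i.hom t)))))

/-- The generators of a free category are transitions conjugated by equality morphisms, since a word
is only propositionally the product of its letters. This absorbs those equality morphisms into the
symmetries `σ`, `σ'`; `map_eq_of_map_conj_eq` goes the other way. -/
theorem CategoryTheory.Functor.map_conj_eq {C : Type u₁} [Category.{v₁} C] {D : Type u₂}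
    [Category.{v₂} D] (F : C ⥤ D) {X Y X' Y' : C} (hX : X' = X) (hY : Y = Y') {f : X ⟶ Y}
    {Z W Z' W' : D} (hZ : Z' = Z) (hW : W = W') {g : Z ⟶ W} {σ : F.obj X ⟶ Z} {σ' : W ⟶ F.obj Y}
    (h : F.map f = σ ≫ g ≫ σ') :
    F.map (eqToHom hX ≫ f ≫ eqToHom hY) =
      (eqToHom (congrArg F.obj hX) ≫ σ ≫ eqToHom hZ.symm) ≫ (eqToHom hZ ≫ g ≫ eqToHom hW) ≫
        (eqToHom hW.symm ≫ σ' ≫ eqToHom (congrArg F.obj hY)) := by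
  subst hX hY hZ hW; simpa using h

theorem CategoryTheory.Functor.map_eq_of_map_conj_eq {C : Type u₁} [Category.{v₁} C]
    {D : Type u₂} [Category.{v₂} D] (F : C ⥤ D) {X Y X' Y' : C} (hX : X' = X) (hY : Y = Y')
    {f : X ⟶ Y} {Z W Z' W' : D} (hZ : Z' = Z) (hW : W = W') {g : Z ⟶ W} {σ : F.obj X' ⟶ Z'}
    {σ' : W' ⟶ F.obj Y'}
    (h : F.map (eqToHom hX ≫ f ≫ eqToHom hY) = σ ≫ (eqToHom hZ ≫ g ≫ eqToHom hW) ≫ σ') :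
    F.map f = (eqToHom (congrArg F.obj hX.symm) ≫ σ ≫ eqToHom hZ) ≫ g ≫
      (eqToHom hW ≫ σ' ≫ eqToHom (congrArg F.obj hY.symm)) := by
  subst hX hY hZ hW; simpa using h

namespace CoherentSpans

variable {A B O : Type u} [SSMC.{u} A] [SSMC.{u} B] [SSMC.{u} O]

/-! ### Coequalizers -/

/-- The functor `lift F h` is a transport along `h` and does not reduce when `h` is not reflexivity.
This lemma and `lift_map` give its values, comparing the elements heterogeneously. -/
theorem lift_obj {D' : CoherentSpans A} {D : CoherentSpans B} (F : SSMFunctor A B)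
    (h : D' = D.pullback F) {X : A} {x : El (D'.ω X)} {y : El (D.ω (F.obj X))} (hxy : HEq x y) :
    (lift F h).obj ⟨X, x⟩ = ⟨F.obj X, y⟩ := by
  subst h; cases hxy; rfl

theorem lift_map {D' : CoherentSpans A} {D : CoherentSpans B} (F : SSMFunctor A B)
    (h : D' = D.pullback F) {X Y : A} {f : X ⟶ Y} {x : El (D'.ω X)} {y : El (D'.ω Y)}
    {x' : El (D.ω (F.obj X))} {y' : El (D.ω (F.obj Y))} {s : D'.Fib f x y}
    {s' : D.Fib (F.map f) x' y'} (hx : HEq x x') (hy : HEq y y') (hs : HEq s s') :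
    HEq ((lift F h).map (Total.homMk f s)) (Total.homMk (F.map f) s') := by
  subst h; cases hx; cases hy; cases hs; rfl

/-- Both composites leave the element component unchanged and act on the base by `l.comp F` and
`r.comp F`, which agree. -/
theorem lift_comp_lift {DO : CoherentSpans O} {DA : CoherentSpans A} {D : CoherentSpans B}
    {l r : SSMFunctor O A} {F : SSMFunctor A B} (h : l.comp F = r.comp F)
    (hl : DO = DA.pullback l) (hr : DO = DA.pullback r) (hF : DA = D.pullback F) :
    (lift l hl).comp (lift F hF) = (lift r hr).comp (lift F hF) := by
  -- Now the lifts of `F` and `l` compute by definition. The equation `hr` remains, relating two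
  -- different pullbacks, so the lift of `r` is handled through `lift_obj` and `lift_map`.
  subst hF hl
  have ho : ∀ X, F.obj (l.obj X) = F.obj (r.obj X) := SSMFunctor.obj_congr h
  have hm : ∀ {X Y : O} (f : X ⟶ Y), HEq (F.map (l.map f)) (F.map (r.map f)) := fun f =>
    SSMFunctor.map_heq_of_eq h rfl rfl (HEq.refl f)
  have hobj (a : Total ((D.pullback F).pullback l)) :
      (lift r hr).obj a = ⟨r.obj a.base, cast (D.el_congr (ho _)) a.el⟩ :=
    lift_obj r hr (cast_heq _ _).symm
  refine SSMFunctor.ext_heq (fun a => ?_) fun {a b} p => ?_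
  · refine Eq.trans ?_ (congrArg (D.pullbackFunctor F).obj (hobj a)).symm
    exact Total.ext_heq (ho _) (cast_heq _ _).symm
  · have hp := lift_map r hr (f := p.1) (x := a.el) (y := b.el) (s := p.2)
      (x' := cast (D.el_congr (ho _)) a.el) (y' := cast (D.el_congr (ho _)) b.el)
      (s' := cast (D.fib_congr (ho _) (ho _) (hm p.1) (cast_heq _ _).symm (cast_heq _ _).symm) p.2)
      (cast_heq _ _).symm (cast_heq _ _).symm (cast_heq _ _).symm
    refine HEq.trans ?_ ((D.pullbackFunctor F).toFunctor.map_heq_of_heq (hobj a) (hobj b) hp).symm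
    exact Total.homMk_heq (ho _) (ho _) (hm p.1) (cast_heq _ _).symm (cast_heq _ _).symm
      (cast_heq _ _).symm

namespace Family

variable {E : Type u} [SSMC.{u} E]

/-! ### Change of base for families -/

section Push

variable (D : CoherentSpans B) (F : SSMFunctor A B)

/-- A family over an object `X`, as a family over `F X`. -/
def pushObj (a : Family (D.pullback F) E) : Family D E := ⟨F.obj a.base, a.fam⟩

variable {D F} in
/-- A morphism of families over `f`, as a morphism over `F f`. -/
def pushMap {a b : Family (D.pullback F) E} (p : a ⟶ b) : pushObj D F a ⟶ pushObj D F b :=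
  Hom.mk (a := pushObj D F a) (b := pushObj D F b) (F.map p.base) fun s => p.app s

theorem pushObj_mul (a b : Family (D.pullback F) E) :
    pushObj D F (a * b) = pushObj D F a * pushObj D F b := by
  refine ext_heq (F.obj_mul _ _) fun z z' h => ?_
  obtain ⟨x, y, rfl⟩ := exists_elMul (D.pullback F).ω (X := a.base) (Y := b.base) z
  obtain rfl := eq_of_heq ((D.elMul_pullback F x y).symm.trans h)
  exact (fam_mul a b x y).trans (fam_mul (pushObj D F a) (pushObj D F b) x y).symm

variable (E) in
/-- The functor on families induced by a functor of the bases. -/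
def push : SSMFunctor (Family (D.pullback F) E) (Family D E) where
  obj := pushObj D F
  map := pushMap
  map_id a := id_ext (F.map_id _) fun x s _ => app_id a s
  map_comp {a b c} p q := Hom.ext_of_eq (F.map_comp _ _) fun {x z} r r' h => by
    obtain ⟨y, s, t, rfl⟩ := (D.pullback F).exists_comp (f := p.base) (g := q.base) r
    -- Composition in `D.pullback F` is composition in `D` followed by a cast; removing the cast
    -- exhibits `r'` as a composite in `D`.
    obtain rfl := eq_of_heq ((cast_heq (D.fib_comp_pullback F p.base q.base x z)
      (D.comp s t)).symm.trans h)
    exact (app_comp p q s t).trans (app_comp (pushMap p) (pushMap q) s t).symm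
  obj_one := ext_heq F.obj_one fun x y _ => rfl
  obj_mul := pushObj_mul D F
  map_tens {a b a' b'} p q := by
    refine Hom.ext_heq (pushObj_mul D F _ _) (pushObj_mul D F _ _) (F.map_tens _ _)
      fun {z z' w w'} r r' hz hw hr => ?_
    obtain ⟨x, x', rfl⟩ := exists_elMul (D.pullback F).ω (X := a.base) (Y := a'.base) z
    obtain ⟨y, y', rfl⟩ := exists_elMul (D.pullback F).ω (X := b.base) (Y := b'.base) w
    obtain ⟨s, t, rfl⟩ := (D.pullback F).exists_tens (f := p.base) (g := q.base) r
    obtain rfl := eq_of_heq ((D.elMul_pullback F x x').symm.trans hz)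
    obtain rfl := eq_of_heq ((D.elMul_pullback F y y').symm.trans hw)
    obtain rfl := eq_of_heq ((cast_heq (D.fib_tens_pullback F p.base q.base x y x' y')
      (D.tens s t)).symm.trans hr)
    exact (app_tens p q s t).trans (app_tens (pushMap p) (pushMap q) s t).symm
  map_braid a b := by
    refine Hom.ext_heq (pushObj_mul D F _ _) (pushObj_mul D F _ _) (F.map_braid _ _)
      fun {z z' w w'} r r' hz hw hr => ?_
    obtain ⟨x, y, rfl⟩ := exists_elMul (D.pullback F).ω (X := a.base) (Y := b.base) z
    obtain ⟨rfl, h⟩ := (D.pullback F).eq_braid (X := a.base) (Y := b.base) r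
    obtain rfl := eq_of_heq h
    obtain rfl := eq_of_heq ((D.elMul_pullback F x y).symm.trans hz)
    obtain rfl := eq_of_heq ((D.elMul_pullback F y x).symm.trans hw)
    obtain rfl := eq_of_heq ((cast_heq (D.fib_braid_pullback F x y)
      (D.braid (X := F.obj a.base) (Y := F.obj b.base) x y)).symm.trans hr)
    exact (app_braid a b x y).trans (app_braid (pushObj D F a) (pushObj D F b) x y).symm

/-- Restriction along the lift of `F` becomes precomposition with `F`: on either side the object `X`
gives the family over `F X` with members `H.obj ⟨F.obj X, x⟩`. -/
theorem curry_pullbackFunctor (H : SSMFunctor (Total D) E) :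
    (curry ((D.pullbackFunctor F).comp H)).comp (push E D F) = F.comp (curry H) := rfl

/-- Although `push` forgets which object of `A` a family came from, that object is still the
argument of the composite functor, so every value of `T` remains visible. -/
theorem curry_comp_push_injective {T T' : SSMFunctor (Total (D.pullback F)) E}
    (h : (curry T).comp (push E D F) = (curry T').comp (push E D F)) : T = T' :=
  SSMFunctor.ext_heq (fun a => fam_congr (SSMFunctor.obj_congr h a.base) (HEq.refl a.el))
    fun {a b} p => Hom.app_heq (SSMFunctor.obj_congr h a.base) (SSMFunctor.obj_congr h b.base)
      (SSMFunctor.map_heq_of_eq h rfl rfl (HEq.refl p.1)) HEq.rfl HEq.rfl (HEq.refl p.2)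

/-- Before pushing, the two families lie over the different objects `l.obj X` and `r.obj X`. Over
`B` their bases coincide by `h`, and equality of the members is the hypothesis that `T` equalizes
the two lifts. -/
theorem comp_curry_comp_push {l r : SSMFunctor O A} (h : l.comp F = r.comp F)
    (hr : (D.pullback F).pullback l = (D.pullback F).pullback r)
    (T : SSMFunctor (Total (D.pullback F)) E)
    (hT : (lift l rfl).comp T = (lift r hr).comp T) :
    l.comp ((curry T).comp (push E D F)) = r.comp ((curry T).comp (push E D F)) := by
  have hobj : ∀ (X : O) {x : El (D.ω (F.obj (l.obj X)))} {y : El (D.ω (F.obj (r.obj X)))},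
      HEq x y → T.obj ⟨l.obj X, x⟩ = T.obj ⟨r.obj X, y⟩ := fun X x y hxy =>
    (SSMFunctor.obj_congr hT ⟨X, x⟩).trans (congrArg T.obj (lift_obj r hr hxy))
  have ho : ∀ X, (l.comp ((curry T).comp (push E D F))).obj X =
      (r.comp ((curry T).comp (push E D F))).obj X := fun X =>
    ext_heq (SSMFunctor.obj_congr h X) fun x y hxy => hobj X hxy
  refine SSMFunctor.ext_heq ho fun {X Y} f => Hom.ext_heq (ho X) (ho Y)
    (SSMFunctor.map_heq_of_eq h rfl rfl (HEq.refl f)) fun {x x' y y'} s s' hx hy hs => ?_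
  refine (SSMFunctor.map_heq_of_eq hT rfl rfl (HEq.refl (Total.homMk
    (D := (D.pullback F).pullback l) (f : X ⟶ Y) (x := x) (y := y) s))).trans ?_
  exact T.toFunctor.map_heq_of_heq (lift_obj r hr hx) (lift_obj r hr hy)
    (lift_map r hr hx hy hs)

end Push

end Family

-- The universal property of `F` is applied twice: with values in `Family D E`, to factor the
-- curried and pushed functor, and with values in `B`, to recognize the factor as a section. The
-- first use is permitted because `Family D E` lies in the same universe as `E`.
open Family in
theorem isCoequalizer_lift {DO : CoherentSpans O} {DA : CoherentSpans A} {D : CoherentSpans B}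
    {l r : SSMFunctor O A} {F : SSMFunctor A B} (h : IsCoequalizer l r F)
    (hl : DO = DA.pullback l) (hr : DO = DA.pullback r) (hF : DA = D.pullback F) :
    IsCoequalizer (lift l hl) (lift r hr) (lift F hF) := by
  refine ⟨lift_comp_lift h.1 hl hr hF, fun E _ T hT => ?_⟩
  subst hF hl
  obtain ⟨K, hK, hK'⟩ := h.2 _ _ (comp_curry_comp_push D F h.1 hr T hT)
  -- The projection of the curried and pushed functor is `F`, so `K.comp (proj D E)` and the
  -- identity both factor `F` through itself.
  have hsec : K.comp (proj D E) = SSMFunctor.id B := by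
    refine (h.2 B F h.1).unique (y₁ := K.comp (proj D E)) ?_ rfl
    exact congrArg (fun k => SSMFunctor.comp k (proj D E)) hK
  refine ⟨uncurry K hsec, ?_, fun H hH => ?_⟩
  · refine curry_comp_push_injective D F ?_
    exact (curry_pullbackFunctor D F _).trans ((congrArg F.comp (curry_uncurry K hsec)).trans hK)
  -- A competing `H` curries to another factorization of the same functor through `F`, hence to `K`.
  · refine curry_injective ((hK' _ ?_).trans (curry_uncurry K hsec).symm)
    exact (curry_pullbackFunctor D F H).symm.trans
      (congrArg (fun k => (curry k).comp (push E D F)) hH)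

/-! ### Freeness -/

section Free

variable {P : PetriNet.{u}} (D : CoherentSpans P.Free) {E : Type u} [SSMC.{u} E]

/-- The family of the places over a place. -/
def familyObj (j : D.net.Interp E) (p : P.Place) : Family D E :=
  ⟨PetriNet.Free.of P p, fun x => j.obj ⟨p, x⟩⟩

/-- The family of the words of places over a word. -/
noncomputable def familyWord (j : D.net.Interp E) (w : P.Free) : Family D E :=
  ⟨w, fun x => FreeMonoid.lift j.obj (FreeMonoid.ofList (D.decorate (FreeMonoid.toList w) x))⟩

/-- The function `decorate` splits an element letter by letter, exactly as the product of families
does, so the product of the one-letter families is the family of decorated words. -/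
theorem lift_familyObj (j : D.net.Interp E) : ∀ w : List P.Place,
    FreeMonoid.lift (D.familyObj j) (FreeMonoid.ofList w) = D.familyWord j (FreeMonoid.ofList w)
  | [] => Family.ext_heq rfl fun _ _ _ => rfl
  | p :: w => by
    refine (map_mul (FreeMonoid.lift (D.familyObj j)) (FreeMonoid.of p)
      (FreeMonoid.ofList w)).trans ((congrArg₂ (· * ·) (FreeMonoid.lift_eval_of _ p)
        (lift_familyObj j w)).trans ?_)
    refine Family.ext_heq rfl fun z z' h => ?_
    obtain rfl := eq_of_heq h
    refine Eq.symm ((map_mul (FreeMonoid.lift j.obj) (FreeMonoid.of (α := D.net.Place)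
      ⟨p, (elSplit D.ω (PetriNet.Free.of P p) (FreeMonoid.ofList w) z).1⟩) (FreeMonoid.ofList
        (D.decorate w (elSplit D.ω (PetriNet.Free.of P p) (FreeMonoid.ofList w) z).2))).trans ?_)
    exact congrArg (· * _) (FreeMonoid.lift_eval_of _ _)

/-- The family of the transitions over a transition. -/
noncomputable def familyHom (j : D.net.Interp E) (t : P.Trans) :
    D.familyWord j (P.src t) ⟶ D.familyWord j (P.tgt t) :=
  Family.Hom.mk (a := D.familyWord j (P.src t)) (b := D.familyWord j (P.tgt t))
    (PetriNet.Free.mk (PetriNet.Term.gen t)) fun {x y} s => j.hom ⟨t, x, y, s⟩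

/-- An interpretation of the net of a Grothendieck construction, as an interpretation of the
original net in families. -/
noncomputable def familyInterp (j : D.net.Interp E) : P.Interp (Family D E) where
  obj := D.familyObj j
  hom t := eqToHom (D.lift_familyObj j (P.src t).toList) ≫ D.familyHom j t ≫
    eqToHom (D.lift_familyObj j (P.tgt t).toList).symm

/-- Each place and each transition of the net of `D` occurs as the index of a member of some family,
and conjugation by equality morphisms loses nothing. -/
theorem familyInterp_injective : Function.Injective (D.familyInterp (E := E)) := by
  rintro ⟨o, m⟩ ⟨o', m'⟩ h
  obtain rfl : o = o' := funext fun ⟨p, x⟩ =>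
    Family.fam_congr (congrFun (congrArg PetriNet.Interp.obj h) p) (HEq.refl x)
  obtain ⟨-, h⟩ := PetriNet.Interp.mk.inj h
  congr 1
  funext ⟨t, x, y, s⟩
  have ht := congrFun (eq_of_heq h) t
  exact eq_of_heq (Family.Hom.app_heq (p := D.familyHom ⟨o, m⟩ t) (p' := D.familyHom ⟨o, m'⟩ t)
    rfl rfl ((SSMC.conj_heq _ _ _).symm.trans ((heq_of_eq ht).trans (SSMC.conj_heq _ _ _)))
    (HEq.refl x) (HEq.refl y) (HEq.refl s))

/-- By `lift_decorate` an object `(X, x)` is the product of its one-letter objects, and `H`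
preserves products. -/
theorem values_eq_familyWord (H : SSMFunctor (Total D) E) (w : P.Free) :
    Family.values H w = D.familyWord (D.gens.map H) w := by
  refine Family.ext_heq rfl fun x y hxy => ?_
  obtain rfl := eq_of_heq hxy
  refine (congrArg H.obj (D.lift_decorate (FreeMonoid.toList w) x)).symm.trans ?_
  exact (DFunLike.congr_fun (FreeMonoid.hom_eq fun p => by
    refine (FreeMonoid.lift_eval_of _ _).trans ?_
    exact congrArg H.obj (FreeMonoid.lift_eval_of D.genObj p).symm :
      FreeMonoid.lift (D.gens.map H).obj = H.objHom.comp (FreeMonoid.lift D.genObj)) _).symm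

/-- Restriction to generators commutes with currying. This turns the condition that `H` extends an
interpretation into the condition that `curry H` extends the associated interpretation in families.
-/
theorem familyInterp_gens_map (H : SSMFunctor (Total D) E) :
    D.familyInterp (D.gens.map H) = P.gens.map (Family.curry H) := by
  refine PetriNet.Interp.ext_of_heq rfl fun t => ?_
  refine (SSMC.conj_heq _ _ _).trans (HEq.symm ((SSMC.conj_heq _ _ _).trans
    ((PetriNet.map_conj_heq _ _ _ _).trans ?_)))
  refine Family.Hom.ext_heq (p := Family.valuesMap H (PetriNet.Free.mk (PetriNet.Term.gen t)))
    (p' := D.familyHom (D.gens.map H) t) (D.values_eq_familyWord H _) (D.values_eq_familyWord H _)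
    HEq.rfl fun {x x' y y'} s s' hx hy hs => ?_
  obtain rfl := eq_of_heq hx
  obtain rfl := eq_of_heq hy
  obtain rfl := eq_of_heq hs
  exact ((SSMC.conj_heq _ _ _).trans (PetriNet.map_conj_heq _ _ _ _)).symm

/-- The universal property of `P.Free` is used with values in `Family D E` and, to see that the
extension is a section, with values in `P.Free` itself. -/
theorem gens_isFree : D.gens.IsFree := by
  intro E _ j
  obtain ⟨K, hK, hK'⟩ := P.gens_isFree (Family D E) (D.familyInterp j)
  have hsec : K.comp (Family.proj D E) = SSMFunctor.id P.Free := by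
    -- Both functors extend the tautological interpretation: the base of each family in
    -- `familyInterp` is the place or transition it belongs to.
    refine (P.gens_isFree P.Free P.gens).unique ?_ ?_
    · refine (P.gens.map_comp K (Family.proj D E)).trans ?_
      rw [hK]
      exact PetriNet.Interp.ext_of_heq rfl fun t => (SSMC.conj_heq _ _ _).trans
        ((PetriNet.map_conj_heq _ _ _ _).trans (SSMC.conj_heq _ _ _).symm)
    · exact PetriNet.Interp.ext_of_heq rfl fun t => SSMC.conj_heq _ _ _
  refine ⟨Family.uncurry K hsec, ?_, fun H hH => ?_⟩
  · refine D.familyInterp_injective ?_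
    rw [familyInterp_gens_map, Family.curry_uncurry, hK]
  · refine Family.curry_injective ((hK' _ ?_).trans (Family.curry_uncurry K hsec).symm)
    rw [← hH, familyInterp_gens_map]

end Free

/-! ### Preservation of transitions -/

/-- Induction on the way the base symmetry is built. Over identities and braidings only the
canonical elements exist, and elements over composites and tensor products split along the
construction. -/
theorem isSymmetry_homMk (D : CoherentSpans B) {X Y : B} {f : X ⟶ Y} (hf : IsSymmetry f) :
    ∀ {x : El (D.ω X)} {y : El (D.ω Y)} (s : D.Fib f x y), IsSymmetry (Total.homMk f s) := by
  induction hf with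
  | id X =>
    intro x y s
    obtain ⟨rfl, h⟩ := D.eq_id s
    obtain rfl := eq_of_heq h
    exact IsSymmetry.id (C := Total D) ⟨X, x⟩
  | braid X Y =>
    intro z w s
    obtain ⟨x, y, rfl⟩ := exists_elMul D.ω z
    obtain ⟨rfl, h⟩ := D.eq_braid s
    obtain rfl := eq_of_heq h
    exact IsSymmetry.braid (C := Total D) ⟨X, x⟩ ⟨Y, y⟩
  | comp _ _ ihf ihg =>
    intro x z r
    obtain ⟨y, s, t, rfl⟩ := D.exists_comp r
    exact (ihf s).comp (ihg t)
  | tens _ _ ihf ihg =>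
    intro z w r
    obtain ⟨x, x', rfl⟩ := exists_elMul D.ω z
    obtain ⟨y, y', rfl⟩ := exists_elMul D.ω w
    obtain ⟨s, t, rfl⟩ := D.exists_tens r
    exact (ihf s).tens (ihg t)

/-- An element over the image of a transition splits along `σ ≫ g ≫ σ'`. The middle part is a
transition of the net of `D` over `g`, and the outer parts are symmetries by `isSymmetry_homMk`. -/
theorem transitionPreserving_lift {P Q : PetriNet.{u}} {D' : CoherentSpans P.Free}
    {D : CoherentSpans Q.Free} {F : SSMFunctor P.Free Q.Free} (h : D' = D.pullback F)
    (hF : PetriNet.TransitionPreserving P.gens Q.gens F) :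
    PetriNet.TransitionPreserving D'.gens D.gens (lift F h) := by
  subst h
  rintro ⟨t, x, y, s⟩
  obtain ⟨g, σ, σ', hσ, hσ', e⟩ := hF t
  -- The hypothesis is restated for the bare transitions, with the equality morphisms in `gens`
  -- moved into the symmetries.
  have key : ∃ (τ : F.obj (P.src t) ⟶ (show Q.Free from Q.src g)) (τ' : (show Q.Free from Q.tgt g) ⟶ F.obj (P.tgt t)),
      IsSymmetry τ ∧ IsSymmetry τ' ∧ F.map (PetriNet.Free.mk (PetriNet.Term.gen t)) =
        τ ≫ PetriNet.Free.mk (PetriNet.Term.gen g) ≫ τ' := by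
    refine ⟨eqToHom (congrArg F.obj (P.lift_of _).symm) ≫ σ ≫ eqToHom (Q.lift_of _),
      eqToHom (Q.lift_of _).symm ≫ σ' ≫ eqToHom (congrArg F.obj (P.lift_of _)),
      (IsSymmetry.eqToHom _).comp (hσ.comp (IsSymmetry.eqToHom _)),
      (IsSymmetry.eqToHom _).comp (hσ'.comp (IsSymmetry.eqToHom _)), ?_⟩
    exact F.toFunctor.map_eq_of_map_conj_eq (P.lift_of _) (P.lift_of _).symm (Q.lift_of _)
      (Q.lift_of _).symm e
  obtain ⟨τ, τ', hτ, hτ', e⟩ := key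
  -- The image of the transition is generalized to a variable `f`, so that its factorization can be
  -- substituted into the type of `s` without a cast.
  have key : ∀ {f : F.obj (P.src t) ⟶ F.obj (P.tgt t)}
      (_ : f = τ ≫ PetriNet.Free.mk (PetriNet.Term.gen g) ≫ τ') (s : D.Fib f x y),
      ∃ (x' : El (D.ω (Q.src g))) (y' : El (D.ω (Q.tgt g))) (a : D.Fib τ x x')
        (b : D.Fib (PetriNet.Free.mk (PetriNet.Term.gen g)) x' y') (c : D.Fib τ' y' y),
        Total.homMk f s = Total.homMk τ a ≫ Total.homMk _ b ≫ Total.homMk τ' c := by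
    rintro _ rfl s
    obtain ⟨x', a, r, rfl⟩ := D.exists_comp s
    obtain ⟨y', b, c, rfl⟩ := D.exists_comp r
    exact ⟨x', y', a, b, c, rfl⟩
  obtain ⟨x', y', a, b, c, hs⟩ := key e s
  have ho := (D.pullback F).lift_decorate
  refine ⟨⟨g, x', y', b⟩,
    eqToHom (congrArg (D.pullbackFunctor F).obj (ho _ _)) ≫ Total.homMk τ a ≫
      eqToHom (D.lift_decorate _ _).symm,
    eqToHom (D.lift_decorate _ _) ≫ Total.homMk τ' c ≫
      eqToHom (congrArg (D.pullbackFunctor F).obj (ho _ _)).symm,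
    (IsSymmetry.eqToHom _).comp ((isSymmetry_homMk D hτ a).comp (IsSymmetry.eqToHom _)),
    (IsSymmetry.eqToHom _).comp ((isSymmetry_homMk D hτ' c).comp (IsSymmetry.eqToHom _)), ?_⟩
  exact (D.pullbackFunctor F).toFunctor.map_conj_eq (ho _ _) (ho _ _).symm
    (D.lift_decorate _ _) (D.lift_decorate _ _).symm hs

/-- The lift of an identification to Grothendieck constructions. -/
theorem isIdentification_lift {M N O : PetriNet.{u}} {DO : CoherentSpans O.Free}
    {DM : CoherentSpans M.Free} {D : CoherentSpans N.Free} {F : SSMFunctor M.Free N.Free}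
    {l r : SSMFunctor O.Free M.Free} {S : Type u₁} [SSMC.{v₁} S] {UM : SSMFunctor M.Free S}
    {UN : SSMFunctor N.Free S} (h : IsIdentification O.gens M.gens UM UN F l r)
    (hl : DO = DM.pullback l) (hr : DO = DM.pullback r) (hF : DM = D.pullback F) :
    IsIdentification DO.gens DM.gens (Terminal.from_ (Total DM)) (Terminal.from_ (Total D))
      (lift F hF) (lift l hl) (lift r hr) where
  -- Semantics in the terminal category is no datum: any two of these functors agree by definition.
  -- The same holds for `equalizes`.
  comp_eq := rfl
  left_preserving := transitionPreserving_lift hl h.left_preserving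
  right_preserving := transitionPreserving_lift hr h.right_preserving
  equalizes := rfl
  isCoequalizer := isCoequalizer_lift h.isCoequalizer hl hr hF

end CoherentSpans

/-! ### The lemma for partial functions and for spans -/

theorem mainTheorem8 (M N O : PetriNet.{u}) (F : SSMFunctor M.Free N.Free)
    (l r : SSMFunctor O.Free M.Free) :
    -- sets and partial functions
    (∀ (UM : SSMFunctor M.Free SetS.{u}) (UN : SSMFunctor N.Free SetS.{u})
      (h : IsIdentification O.gens M.gens UM UN F l r),
      (CoherentSpans.ofSet (l.comp UM)).gens.IsFree ∧
      (CoherentSpans.ofSet UM).gens.IsFree ∧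
      (CoherentSpans.ofSet UN).gens.IsFree ∧
      IsIdentification (CoherentSpans.ofSet (l.comp UM)).gens (CoherentSpans.ofSet UM).gens
        (Terminal.from_ (SetS.Internalization UM)) (Terminal.from_ (SetS.Internalization UN))
        (SetS.lift F h.comp_eq) (SetS.lift l rfl) (SetS.lift r h.equalizes.symm)) ∧
    -- sets and spans, with a coherent choice `D` of spans in the isomorphism classes of `UN`
    (∀ (UM : SSMFunctor M.Free SpanS.{u}) (UN : SSMFunctor N.Free SpanS.{u})
      (h : IsIdentification O.gens M.gens UM UN F l r)
      (D : CoherentSpans N.Free) (_ : D.toSpan = UN),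
      ((D.pullback F).pullback l).gens.IsFree ∧
      (D.pullback F).gens.IsFree ∧
      D.gens.IsFree ∧
      IsIdentification ((D.pullback F).pullback l).gens (D.pullback F).gens
        (Terminal.from_ (D.pullback F).Total) (Terminal.from_ D.Total)
        (CoherentSpans.lift F rfl) (CoherentSpans.lift l rfl)
        (CoherentSpans.lift r (D.pullback_eq_of_comp_eq h.isCoequalizer.1))) :=
  -- The last three arguments of `isIdentification_lift` are the equations presenting the systems on
  -- `O` and `M` as pullbacks; they are determined by the lifts in the statement. For partial
  -- functions they come from `ofSet_comp`.
  ⟨fun _ _ h => ⟨CoherentSpans.gens_isFree _, CoherentSpans.gens_isFree _,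
    CoherentSpans.gens_isFree _, CoherentSpans.isIdentification_lift h _ _ _⟩,
  fun _ _ h _ _ => ⟨CoherentSpans.gens_isFree _, CoherentSpans.gens_isFree _,
    CoherentSpans.gens_isFree _, CoherentSpans.isIdentification_lift h _ _ _⟩⟩
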